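/- **Corollary 4.7 (metric admissible connections).** Let $(M,g)$ be a smooth $n$-dimensional pseudo-Riemannian spin manifold with a fixed spin structure, and let $S$ be its (real or complex) spinor bundle, associated with an irreducible Clifford module, with Clifford multiplication $\gamma$ satisfying $\gamma(X)\gamma(Y)+\gamma(Y)\gamma(X)=-2g(X,Y)$. Let $C$ be a charge conjugation on $S$: a nondegenerate spin-invariant bilinear form such that $C(\varphi,\psi)=\Delta_0\,C(\psi,\varphi)$ and $C(\varphi,\gamma(X)\psi)=\Delta_1\,C(\psi,\gamma(X)\varphi)$ with signs $\Delta_0,\Delta_1\in\{\pm1\}$. Denote by $\nabla$ the Levi-Civita connection of $g$ on $TM$ and its lift to $S$. In a local orthonormal frame write $\gamma_\mu=\gamma(e_\mu)$ and $\gamma_{\mu\nu}=\tfrac12(\gamma_\mu\gamma_\nu-\gamma_\nu\gamma_\mu)$, and raise indices with $g$. For a connection $D$ on $S$ put $\mathcal A=D-\nabla\in\Omega^1(M)\otimes\Gamma\,\mathrm{End}(S)$, let $D^C$ be the connection on $S$ with $$X\big(C(\varphi,\psi)\big)=C(D_X\varphi,\psi)+C(\varphi,D^C_X\psi),$$ and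 put $(\hat D_Z\gamma)(X)\xi=D_Z(\gamma(X)\xi)-\gamma(\nabla_ZX)\xi-\gamma(X)D^C_Z\xi$. The connection $D$ is *admissible* if $\hat D\gamma$ is skew-symmetric, i.e. $(\hat D_Z\gamma)(X)=-(\hat D_X\gamma)(Z)$ for all vector fields $X,Z$. Its torsion is $\mathcal T(X,Y)=(\hat D_X\gamma)(Y)-(\hat D_Y\gamma)(X)$. Let $D$ be a *metric connection* on $S$, i.e. the lift to $S$ of a smooth connection $\nabla^D$ on $TM$ with $\nabla^Dg=0$. Put $$A(X,Y,Z)=g(\nabla^D_XY-\nabla_XY,\,Z),\qquad T(X,Y,Z)=g\big(T^{\nabla^D}(X,Y),Z\big),$$ where $T^{\nabla^D}$ is the torsion of $\nabla^D$. Then $\mathcal A_\mu=\tfrac14A_{\mu\nu\kappa}\gamma^{\nu\kappa}$ and $\mathcal T(X,Y)=\gamma\big(T^{\nabla^D}(X,Y)\big)$. Moreover: 1. $D$ is admissible if and only if $\mathcal A_X$ is of the form $X\rfloor F^{(3)}$, i.e. there is a smooth $3$-form $F$ on $M$ with $\mathcal A_\mu=F_{\mu\nu\kappa}\gamma^{\nu\kappa}$.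 2. $D$ is admissible if and only if its torsion $T$ is totally skew-symmetric. 3. If $D$ is admissible, then $T_{\mu\nu\kappa}=A_{\mu\nu\kappa}-A_{\nu\mu\kappa}=2A_{\mu\nu\kappa}$. -/

import Mathlib

open scoped Manifold ContDiff Bundle Topology

noncomputable section

namespace SpinGeometry

/-! ### Pseudo-Riemannian metrics and affine connections -/

/-- A smooth pseudo-Riemannian metric on an `n`-manifold: a smooth field of symmetric
nondegenerate bilinear forms on the tangent spaces. -/
structure PseudoRiemannianMetric (n : ℕ) (M : Type*) [TopologicalSpace M]
    [ChartedSpace (EuclideanSpace ℝ (Fin n)) M] [IsManifold (𝓡 n) ∞ M] where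
  inner (x : M) : TangentSpace (𝓡 n) x →L[ℝ] TangentSpace (𝓡 n) x →L[ℝ] ℝ
  symm (x : M) (u v : TangentSpace (𝓡 n) x) : inner x u v = inner x v u
  nondegenerate (x : M) (u : TangentSpace (𝓡 n) x) (hu : ∀ v, inner x u v = 0) : u = 0
  contMDiff : ContMDiff (𝓡 n)
    ((𝓡 n).prod 𝓘(ℝ, EuclideanSpace ℝ (Fin n) →L[ℝ] EuclideanSpace ℝ (Fin n) →L[ℝ] ℝ)) ∞
    (fun x ↦ Bundle.TotalSpace.mk'
      (EuclideanSpace ℝ (Fin n) →L[ℝ] EuclideanSpace ℝ (Fin n) →L[ℝ] ℝ) x (inner x))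

section Tangent

variable {n : ℕ} {M : Type*} [TopologicalSpace M]
  [ChartedSpace (EuclideanSpace ℝ (Fin n)) M] [IsManifold (𝓡 n) ∞ M]

variable (n M) in
/-- Affine connections on `M`, that is, covariant derivatives on the tangent bundle.
The value `∇ Y x v` is the derivative of the field `Y` at `x` in the direction `v`. -/
abbrev AffineConnection : Type _ :=
  CovariantDerivative (𝓡 n) (EuclideanSpace ℝ (Fin n))
    (TangentSpace (𝓡 n) : M → Type _)

/-- Differentiability at a point of a (not necessarily continuous) vector field. -/
abbrev FieldDiffAt (Y : Π x : M, TangentSpace (𝓡 n) x) (x : M) : Prop :=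
  MDifferentiableAt (𝓡 n) ((𝓡 n).prod 𝓘(ℝ, EuclideanSpace ℝ (Fin n)))
    (fun y ↦ Bundle.TotalSpace.mk' (EuclideanSpace ℝ (Fin n)) y (Y y)) x

/-- Smoothness of a vector field on a set. -/
abbrev FieldSmoothOn (Y : Π x : M, TangentSpace (𝓡 n) x) (s : Set M) : Prop :=
  ContMDiffOn (𝓡 n) ((𝓡 n).prod 𝓘(ℝ, EuclideanSpace ℝ (Fin n))) ∞
    (fun y ↦ Bundle.TotalSpace.mk' (EuclideanSpace ℝ (Fin n)) y (Y y)) s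

/-- Compatibility with the metric: `v (g(Y, Z)) = g(∇_v Y, Z) + g(Y, ∇_v Z)`. -/
def IsMetricAffine (g : PseudoRiemannianMetric n M) (cov : AffineConnection n M) : Prop :=
  ∀ (x : M) (Y Z : Π y : M, TangentSpace (𝓡 n) y), FieldDiffAt Y x → FieldDiffAt Z x →
    ∀ v : TangentSpace (𝓡 n) x,
      mvfderiv (𝓡 n) (fun y ↦ g.inner y (Y y) (Z y)) x v =
        g.inner x (cov Y x v) (Z x) + g.inner x (Y x) (cov Z x v)

/-- The Levi-Civita connection: metric and torsion free. -/
def IsLeviCivita (g : PseudoRiemannianMetric n M) (cov : AffineConnection n M) : Prop :=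
  IsMetricAffine g cov ∧ cov.torsion = 0

/-- The difference tensor of two affine connections with its last index lowered,
`A(u, v, w) = g(∇'_u v - ∇_u v, w)`. -/
def differenceTensor (g : PseudoRiemannianMetric n M) (cov' cov : AffineConnection n M) (x : M)
    (u v w : TangentSpace (𝓡 n) x) : ℝ :=
  g.inner x (cov'.difference cov x v u) w

/-- The torsion tensor of an affine connection with its last index lowered,
`T(u, v, w) = g(T(u, v), w)`. -/
def loweredTorsion (g : PseudoRiemannianMetric n M) (cov : AffineConnection n M) (x : M)
    (u v w : TangentSpace (𝓡 n) x) : ℝ :=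
  g.inner x (cov.torsion x u v) w

/-- A field of trilinear forms is totally skew-symmetric if it changes sign under the
transpositions of neighbouring arguments (these generate all permutations). -/
def IsTotallySkew (T : ∀ x : M, TangentSpace (𝓡 n) x → TangentSpace (𝓡 n) x →
    TangentSpace (𝓡 n) x → ℝ) : Prop :=
  ∀ (x : M) (u v w : TangentSpace (𝓡 n) x), T x v u w = -T x u v w ∧ T x u w v = -T x u v w

variable (n M) in
/-- Smooth differential 3-forms: fields of alternating trilinear forms whose values on
smooth vector fields are smooth functions. -/
structure ThreeForm where
  toFun (x : M) : TangentSpace (𝓡 n) x [⋀^Fin 3]→L[ℝ] ℝ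
  smooth (X Y Z : Π x : M, TangentSpace (𝓡 n) x) :
    FieldSmoothOn X Set.univ → FieldSmoothOn Y Set.univ → FieldSmoothOn Z Set.univ →
      ContMDiff (𝓡 n) 𝓘(ℝ, ℝ) ∞ (fun x ↦ toFun x ![X x, Y x, Z x])

end Tangent

/-! ### Clifford algebra, spinor modules and charge conjugations -/

/-- The quadratic form `v ↦ -∑ ε_a v_a²` on `ℝⁿ`. In its Clifford algebra
`v w + w v = -2 ∑ ε_a v_a w_a`. -/
def modelForm {n : ℕ} (ε : Fin n → ℤˣ) : QuadraticForm ℝ (Fin n → ℝ) :=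
  QuadraticMap.weightedSumSquares ℝ (fun a ↦ -(((ε a : ℤˣ) : ℤ) : ℝ))

/-- The Clifford algebra of the standard metric `diag(ε)` on `ℝⁿ`, with `v² = -g(v, v)`. -/
abbrev Cl {n : ℕ} (ε : Fin n → ℤˣ) : Type := CliffordAlgebra (modelForm ε)

/-- A spinor module over `𝕂` (real or complex spinors): an irreducible `𝕂`-linear
representation of the Clifford algebra. -/
structure SpinorModule {n : ℕ} (ε : Fin n → ℤˣ) (𝕂 : Type*) [RCLike 𝕂] (S : Type*)
    [NormedAddCommGroup S] [NormedSpace ℝ S] [NormedSpace 𝕂 S] [IsScalarTower ℝ 𝕂 S] where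
  rep : Cl ε →ₐ[ℝ] Module.End 𝕂 S
  nontrivial : Nontrivial S
  irreducible (W : Submodule 𝕂 S) (hW : ∀ a, ∀ φ ∈ W, rep a φ ∈ W) : W = ⊥ ∨ W = ⊤

section Module

variable {n : ℕ} {ε : Fin n → ℤˣ} {𝕂 : Type*} [RCLike 𝕂] {S : Type*}
  [NormedAddCommGroup S] [NormedSpace ℝ S] [NormedSpace 𝕂 S] [IsScalarTower ℝ 𝕂 S]

namespace SpinorModule

/-- Clifford multiplication by a vector of `ℝⁿ`. -/
def mulVec (ρ : SpinorModule ε 𝕂 S) (v : Fin n → ℝ) : Module.End 𝕂 S :=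
  ρ.rep (CliffordAlgebra.ι (modelForm ε) v)

/-- The matrix `γ_a`, Clifford multiplication by the `a`-th standard basis vector. -/
def gamma (ρ : SpinorModule ε 𝕂 S) (a : Fin n) : Module.End 𝕂 S :=
  ρ.mulVec (Pi.single a 1)

/-- The endomorphism `∑ c_{ab} γ^{[a} γ^{b]}`; indices are raised with `diag(ε)`. -/
def cliffordTwo (ρ : SpinorModule ε 𝕂 S) (c : Fin n → Fin n → ℝ) : Module.End 𝕂 S :=
  ∑ a, ∑ b, (((ε a * ε b : ℤˣ) : ℤ) * c a b : ℝ) •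
    ((1 / 2 : ℝ) • (ρ.gamma a * ρ.gamma b - ρ.gamma b * ρ.gamma a))

end SpinorModule

/-- A charge conjugation: a nondegenerate spin-invariant `𝕂`-bilinear form such that
`C(φ, ψ)` and `C(φ, γ(v) ψ)` are symmetric or skew-symmetric in `φ, ψ`, with signs
`Δ₀` and `Δ₁`. -/
structure ChargeConjugation (ρ : SpinorModule ε 𝕂 S) where
  form : LinearMap.BilinForm 𝕂 S
  nondegenerate : form.Nondegenerate
  spin_invariant (s : Cl ε) (hs : s ∈ spinGroup (modelForm ε)) (φ ψ : S) :
    form (ρ.rep s φ) (ρ.rep s ψ) = form φ ψ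
  Δ₀ : ℤˣ
  Δ₁ : ℤˣ
  symm₀ (φ ψ : S) : form φ ψ = ((Δ₀ : ℤ) : 𝕂) * form ψ φ
  symm₁ (v : Fin n → ℝ) (φ ψ : S) :
    form φ (ρ.mulVec v ψ) = ((Δ₁ : ℤ) : 𝕂) * form ψ (ρ.mulVec v φ)

end Module

/-! ### Spin structures and spinor bundles -/

section Spin

variable {n : ℕ} {M : Type*} [TopologicalSpace M]
  [ChartedSpace (EuclideanSpace ℝ (Fin n)) M] [IsManifold (𝓡 n) ∞ M]

/-- A spin structure on `(M, g)`, given by its cocycle: an open cover with smooth orthonormal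
frames of signature `ε` over its members, together with smooth lifts of the changes of frame
to the spin group that satisfy the cocycle condition. -/
structure SpinStructure (g : PseudoRiemannianMetric n M) (ε : Fin n → ℤˣ) (ι : Type*) where
  baseSet : ι → Set M
  isOpen_baseSet (i : ι) : IsOpen (baseSet i)
  indexAt : M → ι
  mem_baseSet_at (x : M) : x ∈ baseSet (indexAt x)
  frame : ι → Fin n → Π x : M, TangentSpace (𝓡 n) x
  contMDiffOn_frame (i : ι) (a : Fin n) : FieldSmoothOn (frame i a) (baseSet i)
  orthonormal (i : ι) (x : M) (hx : x ∈ baseSet i) (a b : Fin n) :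
    g.inner x (frame i a x) (frame i b x) = if a = b then (((ε a : ℤˣ) : ℤ) : ℝ) else 0
  /-- The lift of the change from the `i`-th to the `j`-th frame. -/
  transition : ι → ι → M → Cl ε
  mem_spinGroup (i j : ι) (x : M) (hx : x ∈ baseSet i ∩ baseSet j) :
    transition i j x ∈ spinGroup (modelForm ε)
  /-- Smoothness, in linear coordinates of the Clifford algebra. -/
  contMDiffOn_transition (i j : ι) (f : Cl ε →ₗ[ℝ] ℝ) :
    ContMDiffOn (𝓡 n) 𝓘(ℝ, ℝ) ∞ (fun x ↦ f (transition i j x)) (baseSet i ∩ baseSet j)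
  /-- If a tangent vector has components `v` in the `i`-th frame and `w` in the `j`-th frame,
  then `s v s⁻¹ = w`, where `s` is the transition. -/
  lift (i j : ι) (x : M) (hx : x ∈ baseSet i ∩ baseSet j) (v w : Fin n → ℝ)
    (hvw : ∑ a, v a • frame i a x = ∑ a, w a • frame j a x) :
    transition i j x * CliffordAlgebra.ι (modelForm ε) v =
      CliffordAlgebra.ι (modelForm ε) w * transition i j x
  cocycle (i j k : ι) (x : M) (hx : x ∈ baseSet i ∩ baseSet j ∩ baseSet k) :
    transition j k x * transition i j x = transition i k x

namespace SpinStructure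

variable {g : PseudoRiemannianMetric n M} {ε : Fin n → ℤˣ} {ι : Type*}
  {𝕂 : Type*} [RCLike 𝕂] {S : Type*}
  [NormedAddCommGroup S] [NormedSpace ℝ S] [NormedSpace 𝕂 S] [IsScalarTower ℝ 𝕂 S]
  [FiniteDimensional ℝ S]

theorem transition_self (P : SpinStructure g ε ι) (i : ι) (x : M) (hx : x ∈ P.baseSet i) :
    P.transition i i x = 1 := by
  have h1 := P.cocycle i i i x ⟨⟨hx, hx⟩, hx⟩
  have h2 := spinGroup.star_mul_self_of_mem (P.mem_spinGroup i i x ⟨hx, hx⟩)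
  calc P.transition i i x
      = (star (P.transition i i x) * P.transition i i x) * P.transition i i x := by
        rw [h2, one_mul]
    _ = 1 := by rw [mul_assoc, h1, h2]

/-- The action of Clifford algebra elements on spinors as continuous real-linear maps. -/
def actionL (ρ : SpinorModule ε 𝕂 S) : Cl ε →ₗ[ℝ] (S →L[ℝ] S) where
  toFun s := LinearMap.toContinuousLinearMap ((ρ.rep s).restrictScalars ℝ)
  map_add' s t := by ext φ; simp
  map_smul' c s := by ext φ; simp

@[simp] theorem actionL_apply (ρ : SpinorModule ε 𝕂 S) (s : Cl ε) (φ : S) :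
    actionL ρ s φ = ρ.rep s φ := rfl

theorem contMDiffOn_actionL (P : SpinStructure g ε ι) (ρ : SpinorModule ε 𝕂 S) (i j : ι) :
    ContMDiffOn (𝓡 n) 𝓘(ℝ, S →L[ℝ] S) ∞ (fun x ↦ actionL ρ (P.transition i j x))
      (P.baseSet i ∩ P.baseSet j) := by
  let b := Module.finBasis ℝ (S →L[ℝ] S)
  have h : (fun x ↦ actionL ρ (P.transition i j x)) =
      fun x ↦ ∑ k, ((b.coord k) ∘ₗ actionL ρ) (P.transition i j x) • b k := by
    funext x
    exact (b.sum_repr _).symm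
  rw [h]
  refine contMDiffOn_finsetSum (fun k _ ↦ ?_)
  exact (P.contMDiffOn_transition i j _).smul contMDiffOn_const

/-- The spinor bundle of a spin structure: the vector bundle associated with a spinor module. -/
def spinorCore (P : SpinStructure g ε ι) (ρ : SpinorModule ε 𝕂 S) :
    VectorBundleCore ℝ M S ι where
  baseSet := P.baseSet
  isOpen_baseSet := P.isOpen_baseSet
  indexAt := P.indexAt
  mem_baseSet_at := P.mem_baseSet_at
  coordChange i j x := actionL ρ (P.transition i j x)
  coordChange_self i x hx v := by simp [P.transition_self i x hx]
  continuousOn_coordChange i j := (P.contMDiffOn_actionL ρ i j).continuousOn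
  coordChange_comp i j k x hx v := by
    simp [← P.cocycle i j k x hx]

/-- The fibre of the spinor bundle; as a vector space it is the spinor module, through the
preferred frame at the point. -/
abbrev Spinors (P : SpinStructure g ε ι) (ρ : SpinorModule ε 𝕂 S) : M → Type _ :=
  (P.spinorCore ρ).Fiber

instance (P : SpinStructure g ε ι) (ρ : SpinorModule ε 𝕂 S) :
    (P.spinorCore ρ).IsContMDiff (𝓡 n) ∞ :=
  ⟨fun i j ↦ P.contMDiffOn_actionL ρ i j⟩

instance (P : SpinStructure g ε ι) (ρ : SpinorModule ε 𝕂 S) (x : M) :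
    IsTopologicalAddGroup (P.Spinors ρ x) :=
  inferInstanceAs (IsTopologicalAddGroup S)

instance (P : SpinStructure g ε ι) (ρ : SpinorModule ε 𝕂 S) (x : M) :
    ContinuousSMul ℝ (P.Spinors ρ x) :=
  inferInstanceAs (ContinuousSMul ℝ S)

/-- An endomorphism of the spinor module, acting on the fibre through the preferred frame. -/
def actFiber (P : SpinStructure g ε ι) (ρ : SpinorModule ε 𝕂 S) (x : M)
    (Φ : Module.End 𝕂 S) (ψ : P.Spinors ρ x) : P.Spinors ρ x :=
  Φ (ψ : S)

/-- The orthonormal frame used to identify the fibre at `x` with the spinor module. -/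
def frameAt (P : SpinStructure g ε ι) (x : M) (a : Fin n) : TangentSpace (𝓡 n) x :=
  P.frame (P.indexAt x) a x

/-- Clifford multiplication `γ(v) ψ` of a spinor by a tangent vector. -/
def clifford (P : SpinStructure g ε ι) (ρ : SpinorModule ε 𝕂 S) (x : M)
    (v : TangentSpace (𝓡 n) x) (ψ : P.Spinors ρ x) : P.Spinors ρ x :=
  P.actFiber ρ x (ρ.mulVec (fun a ↦ (((ε a : ℤˣ) : ℤ) : ℝ) * g.inner x v (P.frameAt x a))) ψ

/-- The Clifford action `β_{νκ} γ^{νκ} ψ` of a bilinear form `β` on the tangent space. -/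
def cliffordForm (P : SpinStructure g ε ι) (ρ : SpinorModule ε 𝕂 S) (x : M)
    (β : TangentSpace (𝓡 n) x → TangentSpace (𝓡 n) x → ℝ) (ψ : P.Spinors ρ x) :
    P.Spinors ρ x :=
  P.actFiber ρ x (ρ.cliffordTwo (fun a b ↦ β (P.frameAt x a) (P.frameAt x b))) ψ

/-- The pairing `C(φ, ψ)` of two spinors at `x` given by a charge conjugation. -/
def pairing (P : SpinStructure g ε ι) (ρ : SpinorModule ε 𝕂 S) (C : ChargeConjugation ρ)
    (x : M) (φ ψ : P.Spinors ρ x) : 𝕂 :=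
  C.form (φ : S) (ψ : S)

/-- The representative of a section of the spinor bundle in the `i`-th frame. -/
def localRep (P : SpinStructure g ε ι) (ρ : SpinorModule ε 𝕂 S) (i : ι)
    (σ : Π x : M, P.Spinors ρ x) (x : M) : S :=
  (P.spinorCore ρ).coordChange (P.indexAt x) i x (σ x)

/-- Connections on the spinor bundle. -/
abbrev SpinorConnection (P : SpinStructure g ε ι) (ρ : SpinorModule ε 𝕂 S) : Type _ :=
  CovariantDerivative (𝓡 n) S (P.Spinors ρ)

/-- Differentiability at a point of a section of the spinor bundle. -/
abbrev SpinorDiffAt (P : SpinStructure g ε ι) (ρ : SpinorModule ε 𝕂 S)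
    (σ : Π x : M, P.Spinors ρ x) (x : M) : Prop :=
  MDifferentiableAt (𝓡 n) ((𝓡 n).prod 𝓘(ℝ, S)) (fun y ↦ Bundle.TotalSpace.mk' S y (σ y)) x

/-- The connection form `v ↦ (1/4) g(∇_v e_a, e_b) γ^{ab} ψ` at `x` of the spin lift of an
affine connection, in the preferred orthonormal frame `e` at `x`. -/
def connectionForm (P : SpinStructure g ε ι) (ρ : SpinorModule ε 𝕂 S)
    (cov : AffineConnection n M) (x : M) (ψ : S) : TangentSpace (𝓡 n) x →L[ℝ] S :=
  haveI : FiniteDimensional ℝ (TangentSpace (𝓡 n) x) :=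
    inferInstanceAs (FiniteDimensional ℝ (EuclideanSpace ℝ (Fin n)))
  haveI : T2Space (TangentSpace (𝓡 n) x) :=
    inferInstanceAs (T2Space (EuclideanSpace ℝ (Fin n)))
  LinearMap.toContinuousLinearMap
    { toFun := fun v ↦ (1 / 4 : ℝ) • ρ.cliffordTwo (fun a b ↦
        g.inner x (cov (P.frame (P.indexAt x) a) x v) (P.frameAt x b)) ψ
      map_add' := fun u v ↦ by
        simp [SpinorModule.cliffordTwo, mul_add, add_smul, Finset.sum_add_distrib]
      map_smul' := fun c v ↦ by
        simp only [SpinorModule.cliffordTwo, map_smul, _root_.smul_apply,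
          smul_eq_mul, mul_left_comm _ c, mul_smul, RingHom.id_apply, ← Finset.smul_sum,
          LinearMap.smul_apply, smul_comm _ c] }

theorem connectionForm_add (P : SpinStructure g ε ι) (ρ : SpinorModule ε 𝕂 S)
    (cov : AffineConnection n M) (x : M) (φ ψ : S) :
    P.connectionForm ρ cov x (φ + ψ) = P.connectionForm ρ cov x φ + P.connectionForm ρ cov x ψ := by
  ext v
  simp [connectionForm]

theorem connectionForm_smul (P : SpinStructure g ε ι) (ρ : SpinorModule ε 𝕂 S)
    (cov : AffineConnection n M) (x : M) (c : ℝ) (φ : S) :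
    P.connectionForm ρ cov x (c • φ) = c • P.connectionForm ρ cov x φ := by
  ext v
  simp [connectionForm, LinearMap.map_smul_of_tower, smul_comm _ c]

/-- Local representatives of differentiable spinor fields are differentiable. -/
theorem SpinorDiffAt.localRep {P : SpinStructure g ε ι} {ρ : SpinorModule ε 𝕂 S}
    {σ : Π x : M, P.Spinors ρ x} {x : M} (h : P.SpinorDiffAt ρ σ x) :
    MDifferentiableAt (𝓡 n) 𝓘(ℝ, S) (P.localRep ρ (P.indexAt x) σ) x :=
  (mdifferentiableAt_section (𝓡 n) σ).1 h

/-- The connection on the spinor bundle induced by a metric affine connection (its spin lift):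
in a frame `e` of the spin structure,
`∇_v σ = dσ(v) + (1/4) g(∇_v e_a, e_b) γ^{ab} σ`. -/
def spinLift (P : SpinStructure g ε ι) (ρ : SpinorModule ε 𝕂 S)
    (cov : AffineConnection n M) : P.SpinorConnection ρ where
  toFun σ x := (mvfderiv (𝓡 n) (P.localRep ρ (P.indexAt x) σ) x +
    P.connectionForm ρ cov x (σ x) : TangentSpace (𝓡 n) x →L[ℝ] S)
  isCovariantDerivativeOnUniv :=
    { add := fun {σ σ'} x hσ hσ' _ ↦ by
        have h : P.localRep ρ (P.indexAt x) (σ + σ') =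
            P.localRep ρ (P.indexAt x) σ + P.localRep ρ (P.indexAt x) σ' := by
          funext y
          exact map_add ((P.spinorCore ρ).coordChange (P.indexAt y) (P.indexAt x) y) (σ y : S) _
        have h1 := mvfderiv_add (SpinorDiffAt.localRep hσ) (SpinorDiffAt.localRep hσ')
        have h2 := P.connectionForm_add ρ cov x (σ x) (σ' x)
        rw [h]
        refine (congrArg₂ (· + ·) h1 h2).trans ?_
        exact add_add_add_comm _ _ _ _
      leibniz := fun {σ f} x hσ hf _ ↦ by
        have h : P.localRep ρ (P.indexAt x) (f • σ) = f • P.localRep ρ (P.indexAt x) σ := by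
          funext y
          exact map_smul ((P.spinorCore ρ).coordChange (P.indexAt y) (P.indexAt x) y) (f y)
            (σ y : S)
        have h1 := mvfderiv_smul hf (SpinorDiffAt.localRep hσ)
        have h2 := P.connectionForm_smul ρ cov x (f x) (σ x)
        have h3 : P.localRep ρ (P.indexAt x) σ x = (σ x : S) :=
          (P.spinorCore ρ).coordChange_self _ x (P.mem_baseSet_at x) _
        rw [h3] at h1
        rw [h]
        refine (congrArg₂ (· + ·) h1 h2).trans ?_
        have key : ∀ (c : ℝ) (α β δ : TangentSpace (𝓡 n) x →L[ℝ] S),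
            c • α + β + c • δ = c • (α + δ) + β := by
          intro c α β δ
          rw [add_right_comm, ← smul_add]
        exact key _ _ _ _ }

/-- `D` is the metric connection on the spinor bundle induced by the metric affine connection
`cov`. -/
def IsMetricConnection (P : SpinStructure g ε ι) (ρ : SpinorModule ε 𝕂 S)
    (D : P.SpinorConnection ρ) (cov : AffineConnection n M) : Prop :=
  IsMetricAffine g cov ∧ ∀ (σ : Π x : M, P.Spinors ρ x) (x : M), P.SpinorDiffAt ρ σ x →
    D σ x = P.spinLift ρ cov σ x

/-- `DC` is the connection `D^C` associated with `D`: the charge conjugation is parallel with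
respect to `D ⊗ 1 + 1 ⊗ D^C`, i.e. `v (C(φ, ψ)) = C(D_v φ, ψ) + C(φ, D^C_v ψ)`. -/
def IsChargeAssociated (P : SpinStructure g ε ι) (ρ : SpinorModule ε 𝕂 S)
    (C : ChargeConjugation ρ) (D DC : P.SpinorConnection ρ) : Prop :=
  ∀ (x : M) (φ ψ : Π x : M, P.Spinors ρ x), P.SpinorDiffAt ρ φ x → P.SpinorDiffAt ρ ψ x →
    ∀ v : TangentSpace (𝓡 n) x,
      mvfderiv (𝓡 n) (fun y ↦ P.pairing ρ C y (φ y) (ψ y)) x v =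
        P.pairing ρ C x (D φ x v) (ψ x) + P.pairing ρ C x (φ x) (DC ψ x v)

/-- `(D̂_Z γ)(X) ξ = D_Z (γ(X) ξ) - γ(∇_Z X) ξ - γ(X) D^C_Z ξ`. -/
def hatDGamma (P : SpinStructure g ε ι) (ρ : SpinorModule ε 𝕂 S) (cov : AffineConnection n M)
    (D DC : P.SpinorConnection ρ) (Z X : Π x : M, TangentSpace (𝓡 n) x)
    (ξ : Π x : M, P.Spinors ρ x) (x : M) : P.Spinors ρ x :=
  D (fun y ↦ P.clifford ρ y (X y) (ξ y)) x (Z x) - P.clifford ρ x (cov X x (Z x)) (ξ x) -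
    P.clifford ρ x (X x) (DC ξ x (Z x))

/-- The torsion `𝒯(Z, X) = (D̂_Z γ)(X) - (D̂_X γ)(Z)` of a connection on the spinor bundle,
applied to a spinor field. -/
def spinorTorsion (P : SpinStructure g ε ι) (ρ : SpinorModule ε 𝕂 S)
    (cov : AffineConnection n M) (D DC : P.SpinorConnection ρ)
    (Z X : Π x : M, TangentSpace (𝓡 n) x) (ξ : Π x : M, P.Spinors ρ x) (x : M) :
    P.Spinors ρ x :=
  P.hatDGamma ρ cov D DC Z X ξ x - P.hatDGamma ρ cov D DC X Z ξ x

/-- A connection `D` on the spinor bundle is admissible if `D̂ γ` is skew-symmetric;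
`cov` is the Levi-Civita connection. -/
def IsAdmissible (P : SpinStructure g ε ι) (ρ : SpinorModule ε 𝕂 S) (C : ChargeConjugation ρ)
    (cov : AffineConnection n M) (D : P.SpinorConnection ρ) : Prop :=
  ∃ DC : P.SpinorConnection ρ, P.IsChargeAssociated ρ C D DC ∧
    ∀ (x : M) (Z X : Π x : M, TangentSpace (𝓡 n) x) (ξ : Π x : M, P.Spinors ρ x),
      FieldDiffAt Z x → FieldDiffAt X x → P.SpinorDiffAt ρ ξ x →
        P.hatDGamma ρ cov D DC Z X ξ x = -P.hatDGamma ρ cov D DC X Z ξ x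

/-- The endomorphism-valued one-form `𝒜 = D - ∇`, where `∇` is the spin lift of `cov`. -/
def potential (P : SpinStructure g ε ι) (ρ : SpinorModule ε 𝕂 S) (cov : AffineConnection n M)
    (D : P.SpinorConnection ρ) (x : M) (v : TangentSpace (𝓡 n) x) (ψ : P.Spinors ρ x) :
    P.Spinors ρ x :=
  D.difference (P.spinLift ρ cov) x ψ v

end SpinStructure

end Spin

end SpinGeometry

end

/-!
The spin lift of a metric connection is compatible with Clifford multiplication and leaves `C`
parallel, so `D^C = D` on differentiable spinors and `(D̂_Z γ)(X) = γ(Δ(Z, X))` with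
`Δ(Z, X) = ∇^D_Z X - ∇_Z X`. As `γ` is injective, admissibility says that `A = g(Δ(·, ·), ·)` is
skew in its first two arguments, hence totally skew, since metricity makes it skew in the last two.
The contorsion formula `2 A(u, v, w) = T(u, v, w) - T(v, w, u) + T(w, u, v)` turns this into total
skewness of `T`. Finally, `𝒜_μ = F_{μνκ} γ^{νκ}` forces `F = A / 4`, because a bivector is recovered
from its action on spinors through its commutators with vectors.
-/

noncomputable section

namespace SpinGeometry

/-! ### Clifford algebra -/

section Module

variable {n : ℕ} {ε : Fin n → ℤˣ} {𝕂 : Type*} [RCLike 𝕂] {S : Type*}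
  [NormedAddCommGroup S] [NormedSpace ℝ S] [NormedSpace 𝕂 S] [IsScalarTower ℝ 𝕂 S]

theorem units_intCast_mul_self {R : Type*} [Ring R] (u : ℤˣ) :
    ((u : ℤ) : R) * ((u : ℤ) : R) = 1 := by
  exact_mod_cast congrArg (Int.cast : ℤ → R) (Int.units_coe_mul_self u)

/-- The infinitesimal rotation of `ℝⁿ` with coefficients `c`: it sends `v` to the vector with
components `∑ v_d c_d^b`, the second index being raised with `diag(ε)`. -/
def bivectorAction (ε : Fin n → ℤˣ) (c : Fin n → Fin n → ℝ) (v : Fin n → ℝ) : Fin n → ℝ :=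
  fun b ↦ ((ε b : ℤ) : ℝ) * ∑ d, v d * c d b

namespace SpinorModule

theorem mulVec_sub (ρ : SpinorModule ε 𝕂 S) (v w : Fin n → ℝ) :
    ρ.mulVec (v - w) = ρ.mulVec v - ρ.mulVec w := by
  simp only [mulVec, map_sub]

theorem mulVec_neg (ρ : SpinorModule ε 𝕂 S) (v : Fin n → ℝ) :
    ρ.mulVec (-v) = -ρ.mulVec v := by
  simp only [mulVec, map_neg]

theorem mulVec_eq_sum (ρ : SpinorModule ε 𝕂 S) (v : Fin n → ℝ) :
    ρ.mulVec v = ∑ a, v a • ρ.gamma a := by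
  conv_lhs => rw [pi_eq_sum_univ' v]
  simp only [mulVec, gamma, map_sum, map_smul]

theorem mulVec_mul_mulVec_add_swap (ρ : SpinorModule ε 𝕂 S) (v w : Fin n → ℝ) :
    ρ.mulVec v * ρ.mulVec w + ρ.mulVec w * ρ.mulVec v =
      (-2 * ∑ a, ((ε a : ℤ) : ℝ) * (v a * w a)) • (1 : Module.End 𝕂 S) := by
  simp only [mulVec, ← map_mul, ← map_add, CliffordAlgebra.ι_mul_ι_add_swap]
  rw [AlgHom.commutes, Algebra.algebraMap_eq_smul_one]
  congr 1
  simp only [QuadraticMap.polar, modelForm, QuadraticMap.weightedSumSquares_apply, Finset.mul_sum,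
    ← Finset.sum_sub_distrib, Pi.add_apply, smul_eq_mul]
  exact Finset.sum_congr rfl fun a _ ↦ by ring

theorem gamma_mul_mulVec_add_swap (ρ : SpinorModule ε 𝕂 S) (a : Fin n) (v : Fin n → ℝ) :
    ρ.gamma a * ρ.mulVec v + ρ.mulVec v * ρ.gamma a =
      (-2 * (((ε a : ℤ) : ℝ) * v a)) • (1 : Module.End 𝕂 S) := by
  rw [gamma, mulVec_mul_mulVec_add_swap]
  simp [Pi.single_apply]

theorem mulVec_injective (ρ : SpinorModule ε 𝕂 S) : Function.Injective ρ.mulVec := by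
  intro v w hvw
  have := ρ.nontrivial
  funext a
  have h : (-2 * (((ε a : ℤ) : ℝ) * v a)) • (1 : Module.End 𝕂 S) =
      (-2 * (((ε a : ℤ) : ℝ) * w a)) • (1 : Module.End 𝕂 S) := by
    rw [← gamma_mul_mulVec_add_swap, hvw, gamma_mul_mulVec_add_swap]
  simpa using smul_left_injective ℝ (one_ne_zero (α := Module.End 𝕂 S)) h

theorem cliffordTwo_eq_sum_mul (ρ : SpinorModule ε 𝕂 S) {c : Fin n → Fin n → ℝ}
    (hc : ∀ a b, c b a = -c a b) :
    ρ.cliffordTwo c = ∑ a, ∑ b, (((ε a : ℤ) : ℝ) * ((ε b : ℤ) : ℝ) * c a b) •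
      (ρ.gamma a * ρ.gamma b) := by
  have hswap : ∑ a, ∑ b, (((ε a : ℤ) : ℝ) * ((ε b : ℤ) : ℝ) * c a b) • (ρ.gamma b * ρ.gamma a) =
      -∑ a, ∑ b, (((ε a : ℤ) : ℝ) * ((ε b : ℤ) : ℝ) * c a b) • (ρ.gamma a * ρ.gamma b) := by
    rw [Finset.sum_comm, ← Finset.sum_neg_distrib]
    refine Finset.sum_congr rfl fun a _ ↦ ?_
    rw [← Finset.sum_neg_distrib]
    refine Finset.sum_congr rfl fun b _ ↦ ?_
    rw [hc a b]
    module
  calc ρ.cliffordTwo c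
      = (1 / 2 : ℝ) •
          (∑ a, ∑ b, (((ε a : ℤ) : ℝ) * ((ε b : ℤ) : ℝ) * c a b) • (ρ.gamma a * ρ.gamma b) -
            ∑ a, ∑ b, (((ε a : ℤ) : ℝ) * ((ε b : ℤ) : ℝ) * c a b) • (ρ.gamma b * ρ.gamma a)) := by
        simp only [cliffordTwo, Units.val_mul, Int.cast_mul, ← Finset.sum_sub_distrib,
          Finset.smul_sum, ← smul_sub, smul_comm (1 / 2 : ℝ)]
    _ = _ := by
        rw [hswap]
        module

theorem gamma_mul_gamma_commutator (ρ : SpinorModule ε 𝕂 S) (a b : Fin n) (v : Fin n → ℝ) :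
    ρ.gamma a * ρ.gamma b * ρ.mulVec v - ρ.mulVec v * (ρ.gamma a * ρ.gamma b) =
      (2 * (((ε a : ℤ) : ℝ) * v a)) • ρ.gamma b - (2 * (((ε b : ℤ) : ℝ) * v b)) • ρ.gamma a := by
  calc ρ.gamma a * ρ.gamma b * ρ.mulVec v - ρ.mulVec v * (ρ.gamma a * ρ.gamma b)
      = ρ.gamma a * (ρ.gamma b * ρ.mulVec v + ρ.mulVec v * ρ.gamma b) -
          (ρ.gamma a * ρ.mulVec v + ρ.mulVec v * ρ.gamma a) * ρ.gamma b := by noncomm_ring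
    _ = _ := by
        rw [gamma_mul_mulVec_add_swap, gamma_mul_mulVec_add_swap, mul_smul_comm, smul_mul_assoc,
          mul_one, one_mul]
        module

theorem cliffordTwo_commutator (ρ : SpinorModule ε 𝕂 S) {c : Fin n → Fin n → ℝ}
    (hc : ∀ a b, c b a = -c a b) (v : Fin n → ℝ) :
    ρ.cliffordTwo c * ρ.mulVec v - ρ.mulVec v * ρ.cliffordTwo c =
      (4 : ℝ) • ρ.mulVec (bivectorAction ε c v) := by
  have hterm (a b : Fin n) : (((ε a : ℤ) : ℝ) * ((ε b : ℤ) : ℝ) * c a b) •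
      ((2 * (((ε a : ℤ) : ℝ) * v a)) • ρ.gamma b - (2 * (((ε b : ℤ) : ℝ) * v b)) • ρ.gamma a) =
      (2 * (((ε b : ℤ) : ℝ) * (v a * c a b))) • ρ.gamma b +
        (2 * (((ε a : ℤ) : ℝ) * (v b * c b a))) • ρ.gamma a := by
    rw [hc a b]
    match_scalars
    · linear_combination (2 * ((ε b : ℤ) : ℝ) * c a b * v a) * units_intCast_mul_self (R := ℝ) (ε a)
    · linear_combination
        (-2 * ((ε a : ℤ) : ℝ) * c a b * v b) * units_intCast_mul_self (R := ℝ) (ε b)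
  have hsum : ∑ b, ∑ a, (2 * (((ε b : ℤ) : ℝ) * (v a * c a b))) • ρ.gamma b =
      (2 : ℝ) • ρ.mulVec (bivectorAction ε c v) := by
    simp only [mulVec_eq_sum, bivectorAction, Finset.smul_sum, smul_smul, Finset.mul_sum,
      Finset.sum_smul]
  calc ρ.cliffordTwo c * ρ.mulVec v - ρ.mulVec v * ρ.cliffordTwo c
      = ∑ a, ∑ b, (((ε a : ℤ) : ℝ) * ((ε b : ℤ) : ℝ) * c a b) •
          (ρ.gamma a * ρ.gamma b * ρ.mulVec v - ρ.mulVec v * (ρ.gamma a * ρ.gamma b)) := by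
        simp only [ρ.cliffordTwo_eq_sum_mul hc, Finset.sum_mul, Finset.mul_sum, smul_mul_assoc,
          mul_smul_comm, ← Finset.sum_sub_distrib, ← smul_sub]
    _ = ∑ b, ∑ a, (2 * (((ε b : ℤ) : ℝ) * (v a * c a b))) • ρ.gamma b +
          ∑ a, ∑ b, (2 * (((ε a : ℤ) : ℝ) * (v b * c b a))) • ρ.gamma a := by
        simp only [gamma_mul_gamma_commutator, hterm, Finset.sum_add_distrib]
        rw [Finset.sum_comm]
    _ = (4 : ℝ) • ρ.mulVec (bivectorAction ε c v) := by
        rw [hsum]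
        module

theorem cliffordTwo_mulVec (ρ : SpinorModule ε 𝕂 S) {c : Fin n → Fin n → ℝ}
    (hc : ∀ a b, c b a = -c a b) (v : Fin n → ℝ) (φ : S) :
    (1 / 4 : ℝ) • ρ.cliffordTwo c (ρ.mulVec v φ) =
      ρ.mulVec v ((1 / 4 : ℝ) • ρ.cliffordTwo c φ) + ρ.mulVec (bivectorAction ε c v) φ := by
  have h := LinearMap.congr_fun (ρ.cliffordTwo_commutator hc v) φ
  simp only [LinearMap.sub_apply, Module.End.mul_apply, LinearMap.smul_apply] at h
  rw [LinearMap.map_smul_of_tower, eq_add_of_sub_eq' h]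
  module

theorem cliffordTwo_injOn_skew (ρ : SpinorModule ε 𝕂 S) :
    Set.InjOn ρ.cliffordTwo {c | ∀ a b, c b a = -c a b} := by
  intro c hc c' hc' h
  funext a b
  have hv : ρ.mulVec (bivectorAction ε c (Pi.single a 1)) =
      ρ.mulVec (bivectorAction ε c' (Pi.single a 1)) := by
    refine smul_right_injective (Module.End 𝕂 S) (four_ne_zero (α := ℝ)) ?_
    change (4 : ℝ) • _ = (4 : ℝ) • _
    rw [← ρ.cliffordTwo_commutator hc, h, ρ.cliffordTwo_commutator hc']
  simpa [bivectorAction, Pi.single_apply] using congrFun (ρ.mulVec_injective hv) b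

theorem cliffordTwo_smul_sub (ρ : SpinorModule ε 𝕂 S) (r : ℝ) (c c' : Fin n → Fin n → ℝ) :
    ρ.cliffordTwo (r • (c - c')) = r • (ρ.cliffordTwo c - ρ.cliffordTwo c') := by
  simp only [cliffordTwo, ← Finset.sum_sub_distrib, Finset.smul_sum, Pi.smul_apply, Pi.sub_apply,
    smul_eq_mul]
  exact Finset.sum_congr rfl fun a _ ↦ Finset.sum_congr rfl fun b _ ↦ by module

end SpinorModule

namespace ChargeConjugation

variable {ρ : SpinorModule ε 𝕂 S}

theorem form_mulVec (C : ChargeConjugation ρ) (v : Fin n → ℝ) (φ ψ : S) :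
    C.form φ (ρ.mulVec v ψ) = ((C.Δ₁ : ℤ) : 𝕂) * ((C.Δ₀ : ℤ) : 𝕂) * C.form (ρ.mulVec v φ) ψ := by
  rw [C.symm₁, C.symm₀ ψ, mul_assoc]

theorem form_mulVec_mulVec (C : ChargeConjugation ρ) (v w : Fin n → ℝ) (φ ψ : S) :
    C.form φ (ρ.mulVec v (ρ.mulVec w ψ)) = C.form (ρ.mulVec w (ρ.mulVec v φ)) ψ := by
  rw [form_mulVec, form_mulVec]
  linear_combination C.form (ρ.mulVec w (ρ.mulVec v φ)) ψ *
    (((C.Δ₀ : ℤ) : 𝕂) * ((C.Δ₀ : ℤ) : 𝕂) * units_intCast_mul_self (R := 𝕂) C.Δ₁ +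
      units_intCast_mul_self (R := 𝕂) C.Δ₀)

theorem form_cliffordTwo (C : ChargeConjugation ρ) (c : Fin n → Fin n → ℝ) (φ ψ : S) :
    C.form φ (ρ.cliffordTwo c ψ) = -C.form (ρ.cliffordTwo c φ) ψ := by
  have hgamma (a b : Fin n) :
      C.form φ (ρ.gamma a (ρ.gamma b ψ)) - C.form φ (ρ.gamma b (ρ.gamma a ψ)) =
        -(C.form (ρ.gamma a (ρ.gamma b φ)) ψ - C.form (ρ.gamma b (ρ.gamma a φ)) ψ) := by
    simp only [SpinorModule.gamma, form_mulVec_mulVec, neg_sub]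
  simp only [SpinorModule.cliffordTwo, LinearMap.sum_apply, LinearMap.smul_apply, map_sum,
    LinearMap.sub_apply, map_sub, LinearMap.map_smul_of_tower, Module.End.mul_apply, hgamma,
    smul_neg, Finset.sum_neg_distrib]

theorem eq_of_form_eq (C : ChargeConjugation ρ) {ψ ψ' : S}
    (h : ∀ φ, C.form φ ψ = C.form φ ψ') : ψ = ψ' :=
  sub_eq_zero.1 <| C.nondegenerate.2 _ fun φ ↦ by rw [map_sub, h, sub_self]

end ChargeConjugation

end Module

/-! ### Calculus, tensors and three-forms -/

section Calculus

variable {E : Type*} [NormedAddCommGroup E] [NormedSpace ℝ E]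
  {H : Type*} [TopologicalSpace H] {I : ModelWithCorners ℝ E H}
  {M : Type*} [TopologicalSpace M] [ChartedSpace H M]
  {F₁ F₂ F₃ : Type*} [NormedAddCommGroup F₁] [NormedSpace ℝ F₁]
  [NormedAddCommGroup F₂] [NormedSpace ℝ F₂] [NormedAddCommGroup F₃] [NormedSpace ℝ F₃]

theorem mvfderiv_clm_comp (L : F₁ →L[ℝ] F₂) {f : M → F₁} {x : M}
    (hf : MDifferentiableAt I 𝓘(ℝ, F₁) f x) (v : TangentSpace I x) :
    mvfderiv I (fun y ↦ L (f y)) x v = L (mvfderiv I f x v) :=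
  DFunLike.congr_fun (L.hasFDerivAt.hasMFDerivAt.comp x hf.hasMFDerivAt).mfderiv v

theorem hasMFDerivAt_bilinear (B : F₁ →L[ℝ] F₂ →L[ℝ] F₃) {f : M → F₁} {h : M → F₂} {x : M}
    (hf : MDifferentiableAt I 𝓘(ℝ, F₁) f x) (hh : MDifferentiableAt I 𝓘(ℝ, F₂) h x) :
    HasMFDerivAt I 𝓘(ℝ, F₃) (fun y ↦ B (f y) (h y)) x
      ((B.isBoundedBilinearMap.deriv (f x, h x)).comp
        ((mvfderiv I f x).prod (mvfderiv I h x))) := by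
  have hfh : HasMFDerivAt I 𝓘(ℝ, F₁ × F₂) (fun y ↦ (f y, h y)) x
      ((mvfderiv I f x).prod (mvfderiv I h x)) :=
    ⟨hf.hasMFDerivAt.1.prodMk hh.hasMFDerivAt.1, hf.hasMFDerivAt.2.prodMk hh.hasMFDerivAt.2⟩
  exact (B.isBoundedBilinearMap.hasFDerivAt (f x, h x)).hasMFDerivAt.comp x hfh

theorem mvfderiv_bilinear (B : F₁ →L[ℝ] F₂ →L[ℝ] F₃) {f : M → F₁} {h : M → F₂} {x : M}
    (hf : MDifferentiableAt I 𝓘(ℝ, F₁) f x) (hh : MDifferentiableAt I 𝓘(ℝ, F₂) h x)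
    (v : TangentSpace I x) :
    mvfderiv I (fun y ↦ B (f y) (h y)) x v =
      B (mvfderiv I f x v) (h x) + B (f x) (mvfderiv I h x v) :=
  (DFunLike.congr_fun (hasMFDerivAt_bilinear B hf hh).mfderiv v).trans (add_comm _ _)

theorem mvfderiv_congr_of_eventuallyEq {f h : M → F₁} {x : M} (hfh : f =ᶠ[𝓝 x] h) :
    mvfderiv I f x = mvfderiv I h x := by
  unfold mvfderiv
  rw [hfh.mfderiv_eq, hfh.eq_of_nhds]

variable (I) (F : Type*) [NormedAddCommGroup F] [NormedSpace ℝ F]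
  {V : M → Type*} [TopologicalSpace (Bundle.TotalSpace F V)] [∀ x, AddCommGroup (V x)]
  [∀ x, TopologicalSpace (V x)] [FiberBundle F V]

theorem exists_mdifferentiableAt_section {x : M} (v : V x) :
    ∃ σ : Π y : M, V y, MDifferentiableAt I (I.prod 𝓘(ℝ, F))
      (fun y ↦ Bundle.TotalSpace.mk' F y (σ y)) x ∧ σ x = v :=
  ⟨FiberBundle.extend F v, FiberBundle.mdifferentiableAt_extend I F v,
    by simp⟩

variable {I F} [∀ x, Module ℝ (V x)] [VectorBundle ℝ F V] [ContMDiffVectorBundle 1 F V I]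
  [∀ x, IsTopologicalAddGroup (V x)] [∀ x, ContinuousSMul ℝ (V x)] [FiniteDimensional ℝ F]

theorem difference_apply (D' D : CovariantDerivative I F V) {x : M} {σ : Π y : M, V y}
    (hσ : MDifferentiableAt I (I.prod 𝓘(ℝ, F)) (fun y ↦ Bundle.TotalSpace.mk' F y (σ y)) x)
    (v : TangentSpace I x) :
    D'.difference D x (σ x) v = D' σ x v - D σ x v :=
  DFunLike.congr_fun (IsCovariantDerivativeOn.difference_apply D'.isCovariantDerivativeOnUniv
    D.isCovariantDerivativeOnUniv (Set.mem_univ x) hσ) v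

end Calculus

section Tangent

variable {n : ℕ} {M : Type*} [TopologicalSpace M]
  [ChartedSpace (EuclideanSpace ℝ (Fin n)) M] [IsManifold (𝓡 n) ∞ M]

namespace PseudoRiemannianMetric

theorem mdifferentiableAt_inner (g : PseudoRiemannianMetric n M)
    {X Y : Π y : M, TangentSpace (𝓡 n) y} {x : M} (hX : FieldDiffAt X x) (hY : FieldDiffAt Y x) :
    MDifferentiableAt (𝓡 n) 𝓘(ℝ, ℝ) (fun y ↦ g.inner y (X y) (Y y)) x := by
  have h := MDifferentiableAt.clm_bundle_apply₂ (F₁ := EuclideanSpace ℝ (Fin n))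
    (F₂ := EuclideanSpace ℝ (Fin n)) (F₃ := ℝ) (E₃ := fun _ : M ↦ ℝ)
    ((g.contMDiff x).mdifferentiableAt (by simp)) hX hY
  rw [mdifferentiableAt_totalSpace] at h
  exact h.2

theorem contMDiff_inner (g : PseudoRiemannianMetric n M)
    {X Y : Π y : M, TangentSpace (𝓡 n) y}
    (hX : FieldSmoothOn X Set.univ) (hY : FieldSmoothOn Y Set.univ) :
    ContMDiff (𝓡 n) 𝓘(ℝ, ℝ) ∞ (fun y ↦ g.inner y (X y) (Y y)) := by
  have h := ContMDiff.clm_bundle_apply₂ (F₁ := EuclideanSpace ℝ (Fin n))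
    (F₂ := EuclideanSpace ℝ (Fin n)) (F₃ := ℝ) (E₃ := fun _ : M ↦ ℝ)
    g.contMDiff (contMDiffOn_univ.1 hX) (contMDiffOn_univ.1 hY)
  exact fun x ↦ (Bundle.contMDiffAt_totalSpace.1 (h x)).2

theorem eq_of_inner (g : PseudoRiemannianMetric n M) {x : M}
    {u v : TangentSpace (𝓡 n) x} (h : ∀ w, g.inner x u w = g.inner x v w) : u = v := by
  rw [← sub_eq_zero]
  refine g.nondegenerate x _ fun w ↦ ?_
  rw [map_sub, _root_.sub_apply, h, sub_self]

end PseudoRiemannianMetric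

theorem torsion_sub_torsion (cov' cov : AffineConnection n M) (x : M)
    (u v : TangentSpace (𝓡 n) x) :
    cov'.torsion x u v - cov.torsion x u v =
      cov'.difference cov x v u - cov'.difference cov x u v := by
  obtain ⟨X, hX, rfl⟩ := exists_mdifferentiableAt_section (𝓡 n) (EuclideanSpace ℝ (Fin n)) u
  obtain ⟨Y, hY, rfl⟩ := exists_mdifferentiableAt_section (𝓡 n) (EuclideanSpace ℝ (Fin n)) v
  rw [cov'.torsion_apply hX hY, cov.torsion_apply hX hY, difference_apply cov' cov hX,
    difference_apply cov' cov hY]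
  abel

theorem torsion_eq_difference_sub (cov' : AffineConnection n M) {cov : AffineConnection n M}
    (h : cov.torsion = 0) (x : M) (u v : TangentSpace (𝓡 n) x) :
    cov'.torsion x u v = cov'.difference cov x v u - cov'.difference cov x u v := by
  rw [← torsion_sub_torsion, h]
  exact (sub_zero _).symm

theorem differenceTensor_swap_right {g : PseudoRiemannianMetric n M}
    {cov' cov : AffineConnection n M} (h' : IsMetricAffine g cov') (h : IsMetricAffine g cov)
    (x : M) (u v w : TangentSpace (𝓡 n) x) :
    differenceTensor g cov' cov x u w v = -differenceTensor g cov' cov x u v w := by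
  obtain ⟨Y, hY, rfl⟩ := exists_mdifferentiableAt_section (𝓡 n) (EuclideanSpace ℝ (Fin n)) v
  obtain ⟨Z, hZ, rfl⟩ := exists_mdifferentiableAt_section (𝓡 n) (EuclideanSpace ℝ (Fin n)) w
  have hYZ := (h' x Y Z hY hZ u).symm.trans (h x Y Z hY hZ u)
  simp only [differenceTensor, difference_apply cov' cov hY, difference_apply cov' cov hZ, map_sub,
    _root_.sub_apply]
  rw [g.symm x (cov' Z x u), g.symm x (cov Z x u)]
  linarith

theorem loweredTorsion_eq (g : PseudoRiemannianMetric n M) (cov' : AffineConnection n M)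
    {cov : AffineConnection n M} (h : cov.torsion = 0) (x : M) (u v w : TangentSpace (𝓡 n) x) :
    loweredTorsion g cov' x u v w =
      differenceTensor g cov' cov x u v w - differenceTensor g cov' cov x v u w := by
  simp only [loweredTorsion, differenceTensor, torsion_eq_difference_sub cov' h, map_sub,
    _root_.sub_apply]

theorem two_mul_differenceTensor {g : PseudoRiemannianMetric n M}
    {cov' cov : AffineConnection n M} (h' : IsMetricAffine g cov') (h : IsLeviCivita g cov)
    (x : M) (u v w : TangentSpace (𝓡 n) x) :
    2 * differenceTensor g cov' cov x u v w = loweredTorsion g cov' x u v w -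
      loweredTorsion g cov' x v w u + loweredTorsion g cov' x w u v := by
  have hskew := differenceTensor_swap_right h' h.1
  simp only [loweredTorsion_eq g cov' h.2]
  linarith [hskew x u v w, hskew x v u w, hskew x w u v]

theorem loweredTorsion_eq_two_mul {g : PseudoRiemannianMetric n M}
    (cov' : AffineConnection n M) {cov : AffineConnection n M} (h : cov.torsion = 0)
    (hA : IsTotallySkew (differenceTensor g cov' cov)) (x : M) (u v w : TangentSpace (𝓡 n) x) :
    loweredTorsion g cov' x u v w = 2 * differenceTensor g cov' cov x u v w := by
  rw [loweredTorsion_eq g cov' h, (hA x u v w).1]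
  ring

theorem isTotallySkew_loweredTorsion_iff {g : PseudoRiemannianMetric n M}
    {cov' cov : AffineConnection n M} (h' : IsMetricAffine g cov') (h : IsLeviCivita g cov) :
    IsTotallySkew (loweredTorsion g cov') ↔ IsTotallySkew (differenceTensor g cov' cov) := by
  constructor
  · intro hT
    have hTA (x : M) (u v w : TangentSpace (𝓡 n) x) :
        2 * differenceTensor g cov' cov x u v w = loweredTorsion g cov' x u v w := by
      rw [two_mul_differenceTensor h' h, (hT x v u w).2, (hT x u v w).1, (hT x u w v).1,
        (hT x u v w).2]
      ring
    intro x u v w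
    constructor <;> linarith [hTA x u v w, hTA x v u w, hTA x u w v, hT x u v w]
  · intro hA x u v w
    simp only [loweredTorsion_eq_two_mul cov' h.2 hA, hA x u v w, mul_neg, and_self]

theorem isTotallySkew_differenceTensor_iff {g : PseudoRiemannianMetric n M}
    {cov' cov : AffineConnection n M} (h' : IsMetricAffine g cov') (h : IsMetricAffine g cov) :
    IsTotallySkew (differenceTensor g cov' cov) ↔ ∀ (x : M) (u v : TangentSpace (𝓡 n) x),
      cov'.difference cov x v u = -cov'.difference cov x u v := by
  constructor
  · intro hA x u v
    refine g.eq_of_inner fun w ↦ ?_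
    rw [map_neg, _root_.neg_apply]
    exact (hA x v u w).1
  · intro hdiff x u v w
    refine ⟨?_, differenceTensor_swap_right h' h x u v w⟩
    rw [differenceTensor, differenceTensor, hdiff x v u, map_neg, _root_.neg_apply]

theorem FieldSmoothOn.fieldDiffAt {X : Π y : M, TangentSpace (𝓡 n) y}
    (hX : FieldSmoothOn X Set.univ) (x : M) : FieldDiffAt X x :=
  ((contMDiffOn_univ.1 hX) x).mdifferentiableAt (by simp)

theorem fieldSmoothOn_cov (cov : AffineConnection n M)
    [hcov : CovariantDerivative.ContMDiffCovariantDerivative cov ∞]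
    {X Y : Π y : M, TangentSpace (𝓡 n) y} (hX : FieldSmoothOn X Set.univ)
    (hY : FieldSmoothOn Y Set.univ) : FieldSmoothOn (fun x ↦ cov Y x (X x)) Set.univ :=
  ContMDiffOn.clm_bundle_apply (F₁ := EuclideanSpace ℝ (Fin n))
    (F₂ := EuclideanSpace ℝ (Fin n)) (hcov.contMDiff.contMDiff hY) hX

theorem contMDiff_differenceTensor (g : PseudoRiemannianMetric n M)
    (cov' cov : AffineConnection n M)
    [CovariantDerivative.ContMDiffCovariantDerivative cov' ∞]
    [CovariantDerivative.ContMDiffCovariantDerivative cov ∞]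
    {X Y Z : Π y : M, TangentSpace (𝓡 n) y} (hX : FieldSmoothOn X Set.univ)
    (hY : FieldSmoothOn Y Set.univ) (hZ : FieldSmoothOn Z Set.univ) :
    ContMDiff (𝓡 n) 𝓘(ℝ, ℝ) ∞ fun x ↦ differenceTensor g cov' cov x (X x) (Y x) (Z x) := by
  refine ((g.contMDiff_inner (fieldSmoothOn_cov cov' hX hY) hZ).sub
    (g.contMDiff_inner (fieldSmoothOn_cov cov hX hY) hZ)).congr fun x ↦ ?_
  rw [differenceTensor, difference_apply cov' cov (hY.fieldDiffAt x), map_sub, _root_.sub_apply]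

/-- The difference tensor `A` at a point as a continuous trilinear map. -/
def differenceTrilinear (g : PseudoRiemannianMetric n M) (cov' cov : AffineConnection n M)
    (x : M) : EuclideanSpace ℝ (Fin n) →L[ℝ] EuclideanSpace ℝ (Fin n) →L[ℝ]
      EuclideanSpace ℝ (Fin n) →L[ℝ] ℝ :=
  (ContinuousLinearMap.compL ℝ (EuclideanSpace ℝ (Fin n)) (EuclideanSpace ℝ (Fin n))
    (EuclideanSpace ℝ (Fin n) →L[ℝ] ℝ) (g.inner x)).comp
      (ContinuousLinearMap.flip (E := EuclideanSpace ℝ (Fin n)) (F := EuclideanSpace ℝ (Fin n))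
        (G := EuclideanSpace ℝ (Fin n)) (cov'.difference cov x))

end Tangent

section Alternation

variable {E : Type*} [NormedAddCommGroup E] [NormedSpace ℝ E]

/-- The alternation of a trilinear form: the signed sum over all permutations of its arguments,
without a normalising factor. -/
def alternation (B : E →L[ℝ] E →L[ℝ] E →L[ℝ] ℝ) : E [⋀^Fin 3]→L[ℝ] ℝ :=
  let oneForm : (E →L[ℝ] ℝ) ≃ₗᵢ[ℝ] (E [⋀^Fin 1]→L[ℝ] ℝ) :=
    ContinuousAlternatingMap.ofSubsingletonLIE 0
  .alternatizeUncurryFin <| ContinuousAlternatingMap.alternatizeUncurryFinCLM ℝ E ℝ ∘L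
    oneForm.toContinuousLinearEquiv.toContinuousLinearMap.postcomp E ∘L B

theorem alternation_apply (B : E →L[ℝ] E →L[ℝ] E →L[ℝ] ℝ) (u v w : E) :
    alternation B ![u, v, w] =
      B u v w + -B u w v + (-B v u w + B v w u + (B w u v + -B w v u)) := by
  simp [alternation, ContinuousAlternatingMap.alternatizeUncurryFin_apply, Fin.sum_univ_succ,
    Fin.removeNth]

theorem smul_alternation_apply_of_skew {B : E →L[ℝ] E →L[ℝ] E →L[ℝ] ℝ} (r : ℝ)
    (h₁ : ∀ u v w, B v u w = -B u v w) (h₂ : ∀ u v w, B u w v = -B u v w) (u v w : E) :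
    ((r / 6) • alternation B) ![u, v, w] = r * B u v w := by
  rw [ContinuousAlternatingMap.smul_apply, alternation_apply, smul_eq_mul, h₂ u v w, h₁ u v w,
    h₂ v u w, h₁ u v w, h₁ u w v, h₂ u v w, h₂ w u v, h₁ u w v, h₂ u v w]
  ring

end Alternation

namespace ThreeForm

variable {n : ℕ} {M : Type*} [TopologicalSpace M]
  [ChartedSpace (EuclideanSpace ℝ (Fin n)) M] [IsManifold (𝓡 n) ∞ M]

theorem exists_of_isTotallySkew
    {B : M → EuclideanSpace ℝ (Fin n) →L[ℝ] EuclideanSpace ℝ (Fin n) →L[ℝ]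
      EuclideanSpace ℝ (Fin n) →L[ℝ] ℝ} (r : ℝ)
    (hB : IsTotallySkew fun x u v w ↦ B x u v w)
    (hsmooth : ∀ X Y Z : Π x : M, TangentSpace (𝓡 n) x, FieldSmoothOn X Set.univ →
      FieldSmoothOn Y Set.univ → FieldSmoothOn Z Set.univ →
        ContMDiff (𝓡 n) 𝓘(ℝ, ℝ) ∞ fun x ↦ B x (X x) (Y x) (Z x)) :
    ∃ F : ThreeForm n M, ∀ (x : M) (u v w : TangentSpace (𝓡 n) x),
      F.toFun x ![u, v, w] = r * B x u v w := by
  have halt (x : M) (u v w : TangentSpace (𝓡 n) x) :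
      ((r / 6) • alternation (E := EuclideanSpace ℝ (Fin n)) (B x)) ![u, v, w] =
        r * B x u v w :=
    smul_alternation_apply_of_skew (E := EuclideanSpace ℝ (Fin n)) r
      (fun u v w ↦ (hB x u v w).1) (fun u v w ↦ (hB x u v w).2) u v w
  exact ⟨⟨fun x ↦ (r / 6) • alternation (B x), fun X Y Z hX hY hZ ↦
    (contMDiff_const.mul (hsmooth X Y Z hX hY hZ)).congr fun x ↦ halt x (X x) (Y x) (Z x)⟩, halt⟩

theorem swap_left (F : ThreeForm n M) (x : M) (u v w : TangentSpace (𝓡 n) x) :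
    F.toFun x ![v, u, w] = -F.toFun x ![u, v, w] := by
  have hperm : ![v, u, w] = ![u, v, w] ∘ Equiv.swap 0 1 := by
    funext i
    fin_cases i <;> rfl
  rw [hperm]
  exact (F.toFun x).toAlternatingMap.map_swap ![u, v, w] (by decide)

theorem swap_right (F : ThreeForm n M) (x : M) (u v w : TangentSpace (𝓡 n) x) :
    F.toFun x ![u, w, v] = -F.toFun x ![u, v, w] := by
  have hperm : ![u, w, v] = ![u, v, w] ∘ Equiv.swap 1 2 := by
    funext i
    fin_cases i <;> rfl
  rw [hperm]
  exact (F.toFun x).toAlternatingMap.map_swap ![u, v, w] (by decide)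

end ThreeForm

section Tangent

variable {n : ℕ} {M : Type*} [TopologicalSpace M]
  [ChartedSpace (EuclideanSpace ℝ (Fin n)) M] [IsManifold (𝓡 n) ∞ M]

theorem exists_threeForm_eq_differenceTensor {g : PseudoRiemannianMetric n M}
    {cov' cov : AffineConnection n M}
    [CovariantDerivative.ContMDiffCovariantDerivative cov' ∞]
    [CovariantDerivative.ContMDiffCovariantDerivative cov ∞] (r : ℝ)
    (hA : IsTotallySkew (differenceTensor g cov' cov)) :
    ∃ F : ThreeForm n M, ∀ (x : M) (u v w : TangentSpace (𝓡 n) x),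
      F.toFun x ![u, v, w] = r * differenceTensor g cov' cov x u v w :=
  ThreeForm.exists_of_isTotallySkew (B := differenceTrilinear g cov' cov) r hA
    fun _ _ _ ↦ contMDiff_differenceTensor g cov' cov

end Tangent

/-! ### Frames and the spin lift -/

theorem flip_eq_neg_of_span_eq_top {R V W κ : Type*} [CommRing R] [AddCommGroup V] [Module R V]
    [AddCommGroup W] [Module R W] {e : κ → V} (he : Submodule.span R (Set.range e) = ⊤)
    (B : V →ₗ[R] V →ₗ[R] W) (hB : ∀ a b, B (e a) (e b) = -B (e b) (e a)) : B.flip = -B :=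
  LinearMap.ext_on_range he fun a ↦ LinearMap.ext_on_range he fun b ↦ hB b a

namespace SpinStructure

section Frames

variable {n : ℕ} {M : Type*} [TopologicalSpace M]
  [ChartedSpace (EuclideanSpace ℝ (Fin n)) M] [IsManifold (𝓡 n) ∞ M]
  {g : PseudoRiemannianMetric n M} {ε : Fin n → ℤˣ} {ι : Type*}

/-- The components of a tangent vector in the `i`-th orthonormal frame. -/
def coords (P : SpinStructure g ε ι) (i : ι) (x : M) :
    TangentSpace (𝓡 n) x →ₗ[ℝ] (Fin n → ℝ) where
  toFun v a := ((ε a : ℤ) : ℝ) * g.inner x v (P.frame i a x)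
  map_add' u v := by ext a; simp [mul_add]
  map_smul' r v := by ext a; simp [mul_left_comm]

theorem coords_apply (P : SpinStructure g ε ι) (i : ι) (x : M) (v : TangentSpace (𝓡 n) x)
    (a : Fin n) : P.coords i x v a = ((ε a : ℤ) : ℝ) * g.inner x v (P.frame i a x) := rfl

theorem linearIndependent_frame (P : SpinStructure g ε ι) {i : ι} {x : M}
    (hx : x ∈ P.baseSet i) : LinearIndependent ℝ (fun a ↦ P.frame i a x) := by
  rw [Fintype.linearIndependent_iff]
  intro c hc a
  have h := congrArg (fun v ↦ g.inner x v (P.frame i a x)) hc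
  simpa [map_sum, P.orthonormal i x hx] using h

theorem span_frame (P : SpinStructure g ε ι) {i : ι} {x : M} (hx : x ∈ P.baseSet i) :
    Submodule.span ℝ (Set.range fun a ↦ P.frame i a x) = ⊤ := by
  have : FiniteDimensional ℝ (TangentSpace (𝓡 n) x) :=
    inferInstanceAs (FiniteDimensional ℝ (EuclideanSpace ℝ (Fin n)))
  refine (P.linearIndependent_frame hx).span_eq_top_of_card_eq_finrank' ?_
  rw [Fintype.card_fin]
  exact (finrank_euclideanSpace_fin (𝕜 := ℝ)).symm

theorem eq_of_inner_frame (P : SpinStructure g ε ι) {i : ι} {x : M} (hx : x ∈ P.baseSet i)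
    {u v : TangentSpace (𝓡 n) x}
    (h : ∀ a, g.inner x u (P.frame i a x) = g.inner x v (P.frame i a x)) : u = v := by
  have huv : (g.inner x u).toLinearMap = (g.inner x v).toLinearMap :=
    LinearMap.ext_on_range (P.span_frame hx) h
  exact g.eq_of_inner (LinearMap.congr_fun huv)

theorem coords_injective (P : SpinStructure g ε ι) {i : ι} {x : M} (hx : x ∈ P.baseSet i) :
    Function.Injective (P.coords i x) := by
  refine fun u v h ↦ P.eq_of_inner_frame hx fun a ↦ ?_
  have hε : ((ε a : ℤ) : ℝ) ≠ 0 := by simp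
  exact mul_left_cancel₀ hε (congrFun h a)

theorem sum_coords_smul_frame (P : SpinStructure g ε ι) {i : ι} {x : M} (hx : x ∈ P.baseSet i)
    (v : TangentSpace (𝓡 n) x) : ∑ a, P.coords i x v a • P.frame i a x = v := by
  refine P.eq_of_inner_frame hx fun b ↦ ?_
  simp only [map_sum, _root_.sum_apply, map_smul, _root_.smul_apply, P.orthonormal i x hx,
    coords_apply, smul_eq_mul, mul_ite, mul_zero, Finset.sum_ite_eq', Finset.mem_univ, if_true]
  linear_combination g.inner x v (P.frame i b x) * units_intCast_mul_self (R := ℝ) (ε b)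

theorem eventually_mem_baseSet (P : SpinStructure g ε ι) {i : ι} {x : M}
    (hx : x ∈ P.baseSet i) : ∀ᶠ y in 𝓝 x, y ∈ P.baseSet i :=
  (P.isOpen_baseSet i).mem_nhds hx

theorem fieldDiffAt_frame (P : SpinStructure g ε ι) {i : ι} {x : M} (hx : x ∈ P.baseSet i)
    (a : Fin n) : FieldDiffAt (P.frame i a) x :=
  ((P.contMDiffOn_frame i a).contMDiffAt (P.eventually_mem_baseSet hx)).mdifferentiableAt
    (by simp)

theorem mdifferentiableAt_coords (P : SpinStructure g ε ι) {i : ι} {x : M}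
    (hx : x ∈ P.baseSet i) {X : Π y : M, TangentSpace (𝓡 n) y} (hX : FieldDiffAt X x) :
    MDifferentiableAt (𝓡 n) 𝓘(ℝ, Fin n → ℝ) (fun y ↦ P.coords i y (X y)) x := by
  have hcomp (a : Fin n) :
      MDifferentiableAt (𝓡 n) 𝓘(ℝ, ℝ) (fun y ↦ P.coords i y (X y) a) x :=
    mdifferentiableAt_const.mul (g.mdifferentiableAt_inner hX (P.fieldDiffAt_frame hx a))
  exact ⟨continuousWithinAt_pi.2 fun a ↦ (hcomp a).1,
    differentiableWithinAt_pi.2 fun a ↦ (hcomp a).2⟩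

/-- The connection coefficients `g(∇_v e_a, e_b)` of an affine connection in the `i`-th
orthonormal frame. -/
def connectionCoeff (P : SpinStructure g ε ι) (cov : AffineConnection n M) (i : ι) (x : M)
    (v : TangentSpace (𝓡 n) x) (a b : Fin n) : ℝ :=
  g.inner x (cov (P.frame i a) x v) (P.frame i b x)

theorem connectionCoeff_swap (P : SpinStructure g ε ι) {cov : AffineConnection n M}
    (hcov : IsMetricAffine g cov) {i : ι} {x : M} (hx : x ∈ P.baseSet i)
    (v : TangentSpace (𝓡 n) x) (a b : Fin n) :
    P.connectionCoeff cov i x v b a = -P.connectionCoeff cov i x v a b := by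
  have hconst : (fun y ↦ g.inner y (P.frame i a y) (P.frame i b y)) =ᶠ[𝓝 x]
      fun _ ↦ if a = b then ((ε a : ℤ) : ℝ) else 0 :=
    (P.eventually_mem_baseSet hx).mono fun y hy ↦ P.orthonormal i y hy a b
  have hmetric := hcov x _ _ (P.fieldDiffAt_frame hx a) (P.fieldDiffAt_frame hx b) v
  rw [mvfderiv_congr_of_eventuallyEq hconst, mvfderiv_const, g.symm x (P.frame i a x)] at hmetric
  exact eq_neg_of_add_eq_zero_right hmetric.symm

theorem inner_cov_frame (P : SpinStructure g ε ι) {cov : AffineConnection n M}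
    (hcov : IsMetricAffine g cov) {i : ι} {x : M} (hx : x ∈ P.baseSet i)
    (u v : TangentSpace (𝓡 n) x) (a : Fin n) :
    g.inner x u (cov (P.frame i a) x v) =
      -∑ d, P.coords i x u d * P.connectionCoeff cov i x v d a := by
  have hframe (d : Fin n) : g.inner x (P.frame i d x) (cov (P.frame i a) x v) =
      -P.connectionCoeff cov i x v d a := by
    rw [g.symm, ← P.connectionCoeff_swap hcov hx, connectionCoeff]
  conv_lhs => rw [← P.sum_coords_smul_frame hx u]
  simp only [map_sum, _root_.sum_apply, map_smul, _root_.smul_apply, smul_eq_mul, hframe, mul_neg,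
    Finset.sum_neg_distrib]

theorem mvfderiv_coords (P : SpinStructure g ε ι) {cov : AffineConnection n M}
    (hcov : IsMetricAffine g cov) {i : ι} {x : M} (hx : x ∈ P.baseSet i)
    {X : Π y : M, TangentSpace (𝓡 n) y} (hX : FieldDiffAt X x) (v : TangentSpace (𝓡 n) x) :
    mvfderiv (𝓡 n) (fun y ↦ P.coords i y (X y)) x v = P.coords i x (cov X x v) -
      bivectorAction ε (P.connectionCoeff cov i x v) (P.coords i x (X x)) := by
  funext a
  have hframe := P.fieldDiffAt_frame hx a
  calc mvfderiv (𝓡 n) (fun y ↦ P.coords i y (X y)) x v a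
      = mvfderiv (𝓡 n) (fun y ↦ P.coords i y (X y) a) x v :=
        (mvfderiv_clm_comp (ContinuousLinearMap.proj a) (P.mdifferentiableAt_coords hx hX) v).symm
    _ = ((ε a : ℤ) : ℝ) * mvfderiv (𝓡 n) (fun y ↦ g.inner y (X y) (P.frame i a y)) x v :=
        mvfderiv_clm_comp (((ε a : ℤ) : ℝ) • ContinuousLinearMap.id ℝ ℝ)
          (g.mdifferentiableAt_inner hX hframe) v
    _ = _ := by
        rw [hcov x X _ hX hframe, P.inner_cov_frame hcov hx, mul_add, mul_neg, ← sub_eq_add_neg]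
        rfl

end Frames

variable {n : ℕ} {M : Type*} [TopologicalSpace M]
  [ChartedSpace (EuclideanSpace ℝ (Fin n)) M] [IsManifold (𝓡 n) ∞ M]
  {g : PseudoRiemannianMetric n M} {ε : Fin n → ℤˣ} {ι : Type*}
  {𝕂 : Type*} [RCLike 𝕂] {S : Type*}
  [NormedAddCommGroup S] [NormedSpace ℝ S] [NormedSpace 𝕂 S] [IsScalarTower ℝ 𝕂 S]
  [FiniteDimensional ℝ S]

section SpinLift

/-- Clifford multiplication as a continuous real-bilinear map. -/
def mulVecL (ρ : SpinorModule ε 𝕂 S) : (Fin n → ℝ) →L[ℝ] S →L[ℝ] S :=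
  LinearMap.toContinuousLinearMap (actionL ρ ∘ₗ CliffordAlgebra.ι (modelForm ε))

/-- A charge conjugation as a continuous real-bilinear map. -/
def formL {ρ : SpinorModule ε 𝕂 S} (C : ChargeConjugation ρ) : S →L[ℝ] S →L[ℝ] 𝕂 :=
  LinearMap.toContinuousLinearMap
    (LinearMap.toContinuousLinearMap.toLinearMap ∘ₗ
      (LinearMap.restrictScalarsₗ ℝ 𝕂 S 𝕂 ℝ ∘ₗ C.form.restrictScalars ℝ))

variable (P : SpinStructure g ε ι) (ρ : SpinorModule ε 𝕂 S)

theorem clifford_eq_mulVec (x : M) (v : TangentSpace (𝓡 n) x) (ψ : P.Spinors ρ x) :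
    P.clifford ρ x v ψ = P.actFiber ρ x (ρ.mulVec (P.coords (P.indexAt x) x v)) ψ := rfl

theorem clifford_sub (x : M) (u v : TangentSpace (𝓡 n) x) (ψ : P.Spinors ρ x) :
    P.clifford ρ x (u - v) ψ = P.clifford ρ x u ψ - P.clifford ρ x v ψ := by
  rw [clifford_eq_mulVec, map_sub, SpinorModule.mulVec_sub]
  rfl

theorem clifford_neg (x : M) (u : TangentSpace (𝓡 n) x) (ψ : P.Spinors ρ x) :
    P.clifford ρ x (-u) ψ = -P.clifford ρ x u ψ := by
  rw [clifford_eq_mulVec, map_neg, SpinorModule.mulVec_neg]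
  rfl

theorem clifford_injective (x : M) : Function.Injective (P.clifford ρ x) := fun _ _ h ↦
  P.coords_injective (P.mem_baseSet_at x) (ρ.mulVec_injective (LinearMap.ext (congrFun h)))

theorem localRep_self (σ : Π x : M, P.Spinors ρ x) (x : M) :
    P.localRep ρ (P.indexAt x) σ x = σ x :=
  (P.spinorCore ρ).coordChange_self _ x (P.mem_baseSet_at x) _

variable {P ρ} in
theorem SpinorDiffAt.of_localRep {σ : Π x : M, P.Spinors ρ x} {x : M}
    (h : MDifferentiableAt (𝓡 n) 𝓘(ℝ, S) (P.localRep ρ (P.indexAt x) σ) x) :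
    P.SpinorDiffAt ρ σ x :=
  (mdifferentiableAt_section (𝓡 n) σ).2 h

theorem localRep_clifford {i : ι} (X : Π y : M, TangentSpace (𝓡 n) y)
    (σ : Π x : M, P.Spinors ρ x) {y : M} (hy : y ∈ P.baseSet i) :
    P.localRep ρ i (fun z ↦ P.clifford ρ z (X z) (σ z)) y =
      mulVecL ρ (P.coords i y (X y)) (P.localRep ρ i σ y) := by
  have hy' := P.mem_baseSet_at y
  have hlift := P.lift (P.indexAt y) i y ⟨hy', hy⟩ (P.coords (P.indexAt y) y (X y))
    (P.coords i y (X y)) (by rw [P.sum_coords_smul_frame hy', P.sum_coords_smul_frame hy])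
  have hrep := congrArg ρ.rep hlift
  rw [map_mul, map_mul] at hrep
  exact LinearMap.congr_fun hrep (σ y : S)

theorem localRep_clifford_eventuallyEq (X : Π y : M, TangentSpace (𝓡 n) y)
    (σ : Π x : M, P.Spinors ρ x) (x : M) :
    P.localRep ρ (P.indexAt x) (fun z ↦ P.clifford ρ z (X z) (σ z)) =ᶠ[𝓝 x]
      fun y ↦ mulVecL ρ (P.coords (P.indexAt x) y (X y)) (P.localRep ρ (P.indexAt x) σ y) :=
  (P.eventually_mem_baseSet (P.mem_baseSet_at x)).mono fun _ hy ↦ P.localRep_clifford ρ X σ hy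

theorem pairing_eq_localRep (C : ChargeConjugation ρ) {i : ι} (φ ψ : Π x : M, P.Spinors ρ x)
    {y : M} (hy : y ∈ P.baseSet i) :
    P.pairing ρ C y (φ y) (ψ y) = formL C (P.localRep ρ i φ y) (P.localRep ρ i ψ y) :=
  (C.spin_invariant _ (P.mem_spinGroup _ i y ⟨P.mem_baseSet_at y, hy⟩) _ _).symm

variable {P ρ} in
theorem SpinorDiffAt.clifford {X : Π y : M, TangentSpace (𝓡 n) y}
    {σ : Π x : M, P.Spinors ρ x} {x : M} (hX : FieldDiffAt X x) (hσ : P.SpinorDiffAt ρ σ x) :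
    P.SpinorDiffAt ρ (fun z ↦ P.clifford ρ z (X z) (σ z)) x :=
  .of_localRep <| (hasMFDerivAt_bilinear (mulVecL ρ)
    (P.mdifferentiableAt_coords (P.mem_baseSet_at x) hX)
      hσ.localRep).mdifferentiableAt.congr_of_eventuallyEq
        (P.localRep_clifford_eventuallyEq ρ X σ x)

theorem spinLift_apply (cov : AffineConnection n M) (σ : Π x : M, P.Spinors ρ x) (x : M)
    (v : TangentSpace (𝓡 n) x) :
    P.spinLift ρ cov σ x v = (mvfderiv (𝓡 n) (P.localRep ρ (P.indexAt x) σ) x v +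
      (1 / 4 : ℝ) • ρ.cliffordTwo (P.connectionCoeff cov (P.indexAt x) x v) (σ x : S) : S) := rfl

theorem spinLift_clifford {cov : AffineConnection n M} (hcov : IsMetricAffine g cov)
    {X : Π y : M, TangentSpace (𝓡 n) y} {σ : Π x : M, P.Spinors ρ x} {x : M}
    (hX : FieldDiffAt X x) (hσ : P.SpinorDiffAt ρ σ x) (v : TangentSpace (𝓡 n) x) :
    P.spinLift ρ cov (fun z ↦ P.clifford ρ z (X z) (σ z)) x v =
      P.clifford ρ x (cov X x v) (σ x) + P.clifford ρ x (X x) (P.spinLift ρ cov σ x v) := by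
  have hx := P.mem_baseSet_at x
  set c := P.connectionCoeff cov (P.indexAt x) x v
  set w := P.coords (P.indexAt x) x (X x)
  set s : S := σ x
  set ds : S := mvfderiv (𝓡 n) (P.localRep ρ (P.indexAt x) σ) x v
  have hd : mvfderiv (𝓡 n) (P.localRep ρ (P.indexAt x)
      (fun z ↦ P.clifford ρ z (X z) (σ z))) x v =
      ρ.mulVec (P.coords (P.indexAt x) x (cov X x v) - bivectorAction ε c w) s +
        ρ.mulVec w ds := by
    rw [mvfderiv_congr_of_eventuallyEq (P.localRep_clifford_eventuallyEq ρ X σ x),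
      mvfderiv_bilinear (mulVecL ρ) (P.mdifferentiableAt_coords hx hX) hσ.localRep,
      P.mvfderiv_coords hcov hx hX, localRep_self]
    rfl
  change (mvfderiv (𝓡 n) (P.localRep ρ (P.indexAt x) (fun z ↦ P.clifford ρ z (X z) (σ z))) x v +
      (1 / 4 : ℝ) • ρ.cliffordTwo c (ρ.mulVec w s) : S) =
    ρ.mulVec (P.coords (P.indexAt x) x (cov X x v)) s +
      ρ.mulVec w (ds + (1 / 4 : ℝ) • ρ.cliffordTwo c s)
  rw [hd, ρ.cliffordTwo_mulVec (P.connectionCoeff_swap hcov hx v), SpinorModule.mulVec_sub,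
    LinearMap.sub_apply, map_add]
  abel

theorem mvfderiv_pairing (C : ChargeConjugation ρ) (cov : AffineConnection n M) {x : M}
    {φ ψ : Π x : M, P.Spinors ρ x} (hφ : P.SpinorDiffAt ρ φ x) (hψ : P.SpinorDiffAt ρ ψ x)
    (v : TangentSpace (𝓡 n) x) :
    mvfderiv (𝓡 n) (fun y ↦ P.pairing ρ C y (φ y) (ψ y)) x v =
      P.pairing ρ C x (P.spinLift ρ cov φ x v) (ψ x) +
        P.pairing ρ C x (φ x) (P.spinLift ρ cov ψ x v) := by
  set c := P.connectionCoeff cov (P.indexAt x) x v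
  set s : S := φ x
  set t : S := ψ x
  set dφ : S := mvfderiv (𝓡 n) (P.localRep ρ (P.indexAt x) φ) x v
  set dψ : S := mvfderiv (𝓡 n) (P.localRep ρ (P.indexAt x) ψ) x v
  have hlocal : (fun y ↦ P.pairing ρ C y (φ y) (ψ y)) =ᶠ[𝓝 x] fun y ↦
      formL C (P.localRep ρ (P.indexAt x) φ y) (P.localRep ρ (P.indexAt x) ψ y) :=
    (P.eventually_mem_baseSet (P.mem_baseSet_at x)).mono
      fun _ hy ↦ P.pairing_eq_localRep ρ C φ ψ hy
  calc mvfderiv (𝓡 n) (fun y ↦ P.pairing ρ C y (φ y) (ψ y)) x v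
      = C.form dφ t + C.form s dψ := by
        rw [mvfderiv_congr_of_eventuallyEq hlocal,
          mvfderiv_bilinear (formL C) hφ.localRep hψ.localRep, localRep_self, localRep_self]
        rfl
    _ = C.form (dφ + (1 / 4 : ℝ) • ρ.cliffordTwo c s) t +
          C.form s (dψ + (1 / 4 : ℝ) • ρ.cliffordTwo c t) := by
        simp only [map_add, LinearMap.add_apply, LinearMap.map_smul_of_tower,
          LinearMap.smul_apply, C.form_cliffordTwo]
        module

end SpinLift

namespace IsMetricConnection

variable {P : SpinStructure g ε ι} {ρ : SpinorModule ε 𝕂 S} {D : P.SpinorConnection ρ}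
  {cov' cov : AffineConnection n M}

theorem isChargeAssociated (hD : P.IsMetricConnection ρ D cov') (C : ChargeConjugation ρ) :
    P.IsChargeAssociated ρ C D D := by
  intro x φ ψ hφ hψ v
  rw [hD.2 φ x hφ, hD.2 ψ x hψ]
  exact P.mvfderiv_pairing ρ C cov' hφ hψ v

theorem chargeAssociated_apply (hD : P.IsMetricConnection ρ D cov')
    {C : ChargeConjugation ρ} {DC : P.SpinorConnection ρ} (hDC : P.IsChargeAssociated ρ C D DC)
    {x : M} {ψ : Π x : M, P.Spinors ρ x} (hψ : P.SpinorDiffAt ρ ψ x) : DC ψ x = D ψ x := by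
  ext v
  refine C.eq_of_form_eq fun φ ↦ ?_
  obtain ⟨σ, hσ, rfl⟩ := exists_mdifferentiableAt_section (V := P.Spinors ρ) (x := x) (𝓡 n) S φ
  exact add_left_cancel
    ((hDC x σ ψ hσ hψ v).symm.trans (hD.isChargeAssociated C x σ ψ hσ hψ v))

theorem hatDGamma_eq (hD : P.IsMetricConnection ρ D cov')
    {C : ChargeConjugation ρ} {DC : P.SpinorConnection ρ} (hDC : P.IsChargeAssociated ρ C D DC)
    {x : M} (Z : Π y : M, TangentSpace (𝓡 n) y) {X : Π y : M, TangentSpace (𝓡 n) y}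
    {ξ : Π x : M, P.Spinors ρ x} (hX : FieldDiffAt X x) (hξ : P.SpinorDiffAt ρ ξ x) :
    P.hatDGamma ρ cov D DC Z X ξ x =
      P.clifford ρ x (cov'.difference cov x (X x) (Z x)) (ξ x) := by
  rw [hatDGamma, hD.chargeAssociated_apply hDC hξ, hD.2 _ x (hξ.clifford hX), hD.2 _ x hξ,
    P.spinLift_clifford ρ hD.1 hX hξ, difference_apply cov' cov hX, clifford_sub]
  abel

theorem spinorTorsion_eq (hD : P.IsMetricConnection ρ D cov')
    (hcov : cov.torsion = 0) {C : ChargeConjugation ρ} {DC : P.SpinorConnection ρ}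
    (hDC : P.IsChargeAssociated ρ C D DC) {x : M} {X Y : Π y : M, TangentSpace (𝓡 n) y}
    {ξ : Π x : M, P.Spinors ρ x} (hX : FieldDiffAt X x) (hY : FieldDiffAt Y x)
    (hξ : P.SpinorDiffAt ρ ξ x) :
    P.spinorTorsion ρ cov D DC X Y ξ x = P.clifford ρ x (cov'.torsion x (X x) (Y x)) (ξ x) := by
  rw [spinorTorsion, hD.hatDGamma_eq hDC X hY hξ, hD.hatDGamma_eq hDC Y hX hξ,
    torsion_eq_difference_sub cov' hcov, clifford_sub]

theorem isAdmissible_iff_difference_skew (hD : P.IsMetricConnection ρ D cov')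
    (C : ChargeConjugation ρ) :
    P.IsAdmissible ρ C cov D ↔ ∀ (x : M) (u v : TangentSpace (𝓡 n) x),
      cov'.difference cov x v u = -cov'.difference cov x u v := by
  constructor
  · rintro ⟨DC, hDC, hskew⟩ x u v
    obtain ⟨X, hX, rfl⟩ := exists_mdifferentiableAt_section (𝓡 n) (EuclideanSpace ℝ (Fin n)) u
    obtain ⟨Y, hY, rfl⟩ := exists_mdifferentiableAt_section (𝓡 n) (EuclideanSpace ℝ (Fin n)) v
    refine P.clifford_injective ρ x (funext fun ψ ↦ ?_)
    obtain ⟨ξ, hξ, rfl⟩ := exists_mdifferentiableAt_section (𝓡 n) S ψ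
    rw [clifford_neg, ← hD.hatDGamma_eq hDC X hY hξ, ← hD.hatDGamma_eq hDC Y hX hξ]
    exact hskew x X Y ξ hX hY hξ
  · intro hskew
    have hDC := hD.isChargeAssociated C
    refine ⟨D, hDC, fun x Z X ξ hZ hX hξ ↦ ?_⟩
    rw [hD.hatDGamma_eq hDC Z hX hξ, hD.hatDGamma_eq hDC X hZ hξ, hskew, clifford_neg]

theorem isAdmissible_iff_isTotallySkew_differenceTensor (hD : P.IsMetricConnection ρ D cov')
    (hcov : IsMetricAffine g cov) (C : ChargeConjugation ρ) :
    P.IsAdmissible ρ C cov D ↔ IsTotallySkew (differenceTensor g cov' cov) :=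
  (hD.isAdmissible_iff_difference_skew C).trans
    (isTotallySkew_differenceTensor_iff hD.1 hcov).symm

theorem potential_eq (hD : P.IsMetricConnection ρ D cov') (x : M)
    (v : TangentSpace (𝓡 n) x) (ψ : P.Spinors ρ x) :
    P.potential ρ cov D x v ψ =
      P.cliffordForm ρ x (fun a b ↦ 1 / 4 * differenceTensor g cov' cov x v a b) ψ := by
  obtain ⟨σ, hσ, rfl⟩ := exists_mdifferentiableAt_section (𝓡 n) S ψ
  have hx := P.mem_baseSet_at x
  have hcoeff :
      (fun a b ↦ 1 / 4 * differenceTensor g cov' cov x v (P.frameAt x a) (P.frameAt x b)) =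
        (1 / 4 : ℝ) • (P.connectionCoeff cov' (P.indexAt x) x v -
          P.connectionCoeff cov (P.indexAt x) x v) := by
    funext a b
    rw [differenceTensor, frameAt, difference_apply cov' cov (P.fieldDiffAt_frame hx a), map_sub,
      _root_.sub_apply]
    rfl
  rw [potential, difference_apply D (P.spinLift ρ cov) hσ, hD.2 σ x hσ, spinLift_apply,
    spinLift_apply, cliffordForm, hcoeff, actFiber, SpinorModule.cliffordTwo_smul_sub]
  exact (add_sub_add_left_eq_sub _ _ _).trans (smul_sub (1 / 4 : ℝ) _ _).symm

theorem isTotallySkew_of_potential_eq (hD : P.IsMetricConnection ρ D cov')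
    (hcov : IsMetricAffine g cov) {F : ThreeForm n M}
    (hF : ∀ (x : M) (v : TangentSpace (𝓡 n) x) (ψ : P.Spinors ρ x),
      P.potential ρ cov D x v ψ = P.cliffordForm ρ x (fun a b ↦ F.toFun x ![v, a, b]) ψ) :
    IsTotallySkew (differenceTensor g cov' cov) := by
  have hright := differenceTensor_swap_right hD.1 hcov
  have hframe (x : M) (v : TangentSpace (𝓡 n) x) (a b : Fin n) :
      1 / 4 * differenceTensor g cov' cov x v (P.frameAt x a) (P.frameAt x b) =
        F.toFun x ![v, P.frameAt x a, P.frameAt x b] := by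
    refine congrFun (congrFun (ρ.cliffordTwo_injOn_skew (fun a b ↦ ?_) (fun a b ↦ ?_)
      (LinearMap.ext fun ψ ↦ (hD.potential_eq x v ψ).symm.trans (hF x v ψ))) a) b
    · exact (congrArg (1 / 4 * ·) (hright x v _ _)).trans (mul_neg _ _)
    · exact F.swap_right x v _ _
  refine (isTotallySkew_differenceTensor_iff hD.1 hcov).2 fun x u v ↦ ?_
  have hx := P.mem_baseSet_at x
  have hskew (a b : Fin n) : cov'.difference cov x (P.frameAt x a) (P.frameAt x b) =
      -cov'.difference cov x (P.frameAt x b) (P.frameAt x a) := by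
    refine P.eq_of_inner_frame hx fun d ↦ ?_
    have hba := hframe x (P.frameAt x b) a d
    rw [F.swap_left, ← hframe x (P.frameAt x a) b d] at hba
    rw [map_neg, _root_.neg_apply]
    simp only [differenceTensor] at hba
    exact mul_left_cancel₀ (by norm_num : (1 / 4 : ℝ) ≠ 0) (hba.trans (mul_neg _ _).symm)
  exact LinearMap.congr_fun₂ (flip_eq_neg_of_span_eq_top (P.span_frame hx)
    (ContinuousLinearMap.coeLM ℝ ∘ₗ (cov'.difference cov x).toLinearMap) hskew) u v

end IsMetricConnection

end SpinStructure

end SpinGeometry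

end

open SpinGeometry in
theorem corollary4p7_general {n : ℕ} {M : Type*} [TopologicalSpace M]
    [ChartedSpace (EuclideanSpace ℝ (Fin n)) M] [IsManifold (𝓡 n) ∞ M]
    (g : PseudoRiemannianMetric n M) {ε : Fin n → ℤˣ} {ι : Type*} (P : SpinStructure g ε ι)
    {𝕂 : Type*} [RCLike 𝕂] {S : Type*} [NormedAddCommGroup S] [NormedSpace ℝ S]
    [NormedSpace 𝕂 S] [IsScalarTower ℝ 𝕂 S] [FiniteDimensional ℝ S]
    (ρ : SpinorModule ε 𝕂 S) (C : ChargeConjugation ρ)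
    (nabla : AffineConnection n M)
    [CovariantDerivative.ContMDiffCovariantDerivative nabla ∞]
    (hnabla : IsLeviCivita g nabla)
    (nablaD : AffineConnection n M)
    [CovariantDerivative.ContMDiffCovariantDerivative nablaD ∞]
    (D : P.SpinorConnection ρ) (hD : P.IsMetricConnection ρ D nablaD) :
    (∀ (x : M) (v : TangentSpace (𝓡 n) x) (ψ : P.Spinors ρ x),
      P.potential ρ nabla D x v ψ =
        P.cliffordForm ρ x (fun a b ↦ 1 / 4 * differenceTensor g nablaD nabla x v a b) ψ) ∧
    (∀ DC : P.SpinorConnection ρ, P.IsChargeAssociated ρ C D DC →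
      ∀ (x : M) (X Y : Π y : M, TangentSpace (𝓡 n) y) (ξ : Π y : M, P.Spinors ρ y),
        FieldDiffAt X x → FieldDiffAt Y x → P.SpinorDiffAt ρ ξ x →
          P.spinorTorsion ρ nabla D DC X Y ξ x =
            P.clifford ρ x (nablaD.torsion x (X x) (Y x)) (ξ x)) ∧
    (P.IsAdmissible ρ C nabla D ↔
      ∃ F : ThreeForm n M, ∀ (x : M) (v : TangentSpace (𝓡 n) x) (ψ : P.Spinors ρ x),
        P.potential ρ nabla D x v ψ =
          P.cliffordForm ρ x (fun a b ↦ F.toFun x ![v, a, b]) ψ) ∧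
    (P.IsAdmissible ρ C nabla D ↔ IsTotallySkew (loweredTorsion g nablaD)) ∧
    (∀ (x : M) (u v w : TangentSpace (𝓡 n) x), loweredTorsion g nablaD x u v w =
      differenceTensor g nablaD nabla x u v w - differenceTensor g nablaD nabla x v u w) ∧
    (P.IsAdmissible ρ C nabla D → ∀ (x : M) (u v w : TangentSpace (𝓡 n) x),
      loweredTorsion g nablaD x u v w = 2 * differenceTensor g nablaD nabla x u v w) := by
  have hadm := hD.isAdmissible_iff_isTotallySkew_differenceTensor hnabla.1 C
  refine ⟨hD.potential_eq, fun DC hDC x X Y ξ ↦ hD.spinorTorsion_eq hnabla.2 hDC,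
    hadm.trans ⟨fun hA ↦ ?_, fun ⟨F, hF⟩ ↦ hD.isTotallySkew_of_potential_eq hnabla.1 hF⟩,
    hadm.trans (isTotallySkew_loweredTorsion_iff hD.1 hnabla).symm,
    loweredTorsion_eq g nablaD hnabla.2,
    fun h ↦ loweredTorsion_eq_two_mul nablaD hnabla.2 (hadm.1 h)⟩
  obtain ⟨F, hF⟩ := exists_threeForm_eq_differenceTensor (1 / 4) hA
  refine ⟨F, fun x v ψ ↦ ?_⟩
  simp only [hF]
  exact hD.potential_eq x v ψ

open SpinGeometry in
theorem corollary4p7 {n : ℕ} {M : Type*} [TopologicalSpace M] [T2Space M] [SigmaCompactSpace M]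
    [ChartedSpace (EuclideanSpace ℝ (Fin n)) M] [IsManifold (𝓡 n) ∞ M]
    (g : PseudoRiemannianMetric n M) {ε : Fin n → ℤˣ} {ι : Type*} (P : SpinStructure g ε ι)
    {𝕂 : Type*} [RCLike 𝕂] {S : Type*} [NormedAddCommGroup S] [NormedSpace ℝ S]
    [NormedSpace 𝕂 S] [IsScalarTower ℝ 𝕂 S] [FiniteDimensional ℝ S]
    (ρ : SpinorModule ε 𝕂 S) (C : ChargeConjugation ρ)
    (nabla : AffineConnection n M)
    [CovariantDerivative.ContMDiffCovariantDerivative nabla ∞]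
    (hnabla : IsLeviCivita g nabla)
    (nablaD : AffineConnection n M)
    [CovariantDerivative.ContMDiffCovariantDerivative nablaD ∞]
    (D : P.SpinorConnection ρ) (hD : P.IsMetricConnection ρ D nablaD) :
    (∀ (x : M) (v : TangentSpace (𝓡 n) x) (ψ : P.Spinors ρ x),
      P.potential ρ nabla D x v ψ =
        P.cliffordForm ρ x (fun a b ↦ 1 / 4 * differenceTensor g nablaD nabla x v a b) ψ) ∧
    (∀ DC : P.SpinorConnection ρ, P.IsChargeAssociated ρ C D DC →
      ∀ (x : M) (X Y : Π y : M, TangentSpace (𝓡 n) y) (ξ : Π y : M, P.Spinors ρ y),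
        FieldDiffAt X x → FieldDiffAt Y x → P.SpinorDiffAt ρ ξ x →
          P.spinorTorsion ρ nabla D DC X Y ξ x =
            P.clifford ρ x (nablaD.torsion x (X x) (Y x)) (ξ x)) ∧
    (P.IsAdmissible ρ C nabla D ↔
      ∃ F : ThreeForm n M, ∀ (x : M) (v : TangentSpace (𝓡 n) x) (ψ : P.Spinors ρ x),
        P.potential ρ nabla D x v ψ =
          P.cliffordForm ρ x (fun a b ↦ F.toFun x ![v, a, b]) ψ) ∧
    (P.IsAdmissible ρ C nabla D ↔ IsTotallySkew (loweredTorsion g nablaD)) ∧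
    (P.IsAdmissible ρ C nabla D → ∀ (x : M) (u v w : TangentSpace (𝓡 n) x),
      loweredTorsion g nablaD x u v w =
        differenceTensor g nablaD nabla x u v w - differenceTensor g nablaD nabla x v u w ∧
      loweredTorsion g nablaD x u v w = 2 * differenceTensor g nablaD nabla x u v w) :=
  have ⟨h𝒜, h𝒯, h₁, h₂, hT, hT₂⟩ := corollary4p7_general g P ρ C nabla hnabla nablaD D hD
  ⟨h𝒜, h𝒯, h₁, h₂, fun h x u v w ↦ ⟨hT x u v w, hT₂ h x u v w⟩⟩
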